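/- Let $N=(V,E,\sigma)$ be a network, i.e. a finite connected graph $(V,E)$ with edge costs $\sigma:E\to\{1,2,\dots\}$, let $\emptyset\ne R\subseteq V$ be a set of terminals, let $r\in R$ be a root, and put $R'=R\setminus\{r\}$. For $X\subseteq V$ let $\mathrm{smt}(X)$ be the least cost of a tree in $N$ containing $X$, and let $l^*(u,I)=\mathrm{smt}(I\cup\{u\})$. A Steiner heuristic $h^*:V\times 2^R\to\{0,1,2,\dots\}$ is admissible if $h^*(u,I)\le l^*(u,I)$ for all $u\in V$ and $\{r\}\subseteq I\subseteq R$. The DS* algorithm works on tuples $(u,I)\in V\times 2^{R'}$. Initially $l(u,\{u\})=0$ for $u\in R'$, $l(u,\emptyset)=0$ for $u\in V$, all other $l(u,I)$ are $\infty$, all retracing sets $b(u,I)$ are empty, $Q=\{(u,\{u\}) : u\in R'\}$ and $P=\emptyset$. While $(r,R')\notin P$, it takes $(u,I)\in Q$ with $l(u,I)+h^*(u,R\setminus I)$ minimal, moves it from $Q$ to $P$, and then does the following. (a) For each $\emptyset\ne J\subseteq R'\setminus I$ with $(u,J)\in P$: if $l(u,I)+l(u,J)<l(u,I\cup J)$,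 this sum becomes the new value of $l(u,I\cup J)$, $b(u,I\cup J)\leftarrow\{(u,I),(u,J)\}$, and $(u,I\cup J)$ is put into $Q$ unless it is pruned. (b) For each edge $\{u,v\}$: if $l(u,I)+\sigma(\{u,v\})<l(v,I)$, this sum becomes the new value of $l(v,I)$, $b(v,I)\leftarrow\{(u,I)\}$, and $(v,I)$ is put into $Q$ unless it is pruned. At the end it returns $l(r,R')$ and the edge set retraced recursively from $(r,R')$ along $b$, adding the edge $\{u,u'\}$ whenever $(u',I')\in b(u,I)$ and $u\ne u'$. If $R=\{r\}$, then $Q$ is empty at the start and the loop ends at once. Pruning keeps partial functions $U$ (upper bounds, initially undefined, i.e. $\infty$) and $S$. Let $d_N$ denote the distance in $N$ and $sd(A,B)=\min_{x\in A,y\in B}d_N(x,y)$. A call $\mathit{prune}(v,J)$ sets $U(J)\leftarrow\min\{U(J),\,l(v,J)+\min\{sd(J,R\setminus J),sd(\{v\},R\setminus J)\}\}$; if this changes $U(J)$, it also sets $S(J)\leftarrow\{z\}$ for some $z\in R\setminus J$ attaining the inner minimum. It answers yes if $l(v,J)>U(J)$. In (a), if $U(I)$ and $U(J)$ are defined and $S(I)\cap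 J=\emptyset$ or $S(J)\cap I=\emptyset$, then first $U(I\cup J)\leftarrow U(I)+U(J)$ and $S(I\cup J)\leftarrow(S(I)\cup S(J))\setminus(I\cup J)$; then $\mathit{prune}(u,I\cup J)$ decides. In (b), $\mathit{prune}(u,I)$ decides, or, in a variant, $\mathit{prune}(v,I)$. Pruning may also be switched off. Theorem. There is a universal constant $C$ such that for every such $N$, $R$ and $r$, every admissible Steiner heuristic $h^*$, each of these three forms of pruning, and every way of breaking ties and ordering the inner loops, the DS* algorithm terminates, with $(r,R')\in P$ if $R\neq\{r\}$, after at most $$C\cdot |R|\cdot\bigl(|V|+2^{|R|}\bigr)^{|V|+|R|}$$ steps; that is, DS* runs in time $\mathcal O\bigl(|R|\cdot(|V|+2^{|R|})^{|V|+|R|}\bigr)$. Steps are counted on a random access machine with unit-cost arithmetic, comparisons and table accesses, unit-cost evaluation of $h^*$, cost $|R|$ for an operation on sets of terminals, and selection of the minimum by a scan of $Q$; initialization (with $|V|^3$ steps for the table of all distances $d_N$), pruning and retracing are counted. -/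

import Mathlib

/-!  Minimum Steiner tree instances, Steiner heuristics, and the DS* algorithm as a
nondeterministic transition system with a clock. -/

universe u

/-- An instance of the minimum Steiner tree problem: a connected graph with positive integer
edge costs (a network) and a non-empty set `R` of terminals. The values of `cost` outside the
edge set are irrelevant. -/
structure STPInstance (V : Type u) where
  graph : SimpleGraph V
  connected : graph.Connected
  cost : Sym2 V → ℕ
  cost_pos : ∀ e ∈ graph.edgeSet, 0 < cost e
  R : Finset V
  R_nonempty : R.Nonempty

/-- A vertex together with a set of terminals. -/
abbrev Tuple (V : Type u) := V × Finset V

noncomputable section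

namespace STPInstance

variable {V : Type u}

/-- The cost `c_N(T)` of a subgraph: the sum of the costs of its edges. -/
def subgraphCost (N : STPInstance V) (T : N.graph.Subgraph) : ℕ :=
  ∑ᶠ e ∈ T.edgeSet, N.cost e

/-- `T` is a Steiner tree of the network for the terminal set `X`. -/
def IsSteinerTree (N : STPInstance V) (X : Finset V) (T : N.graph.Subgraph) : Prop :=
  (X : Set V) ⊆ T.verts ∧ T.coe.IsTree

/-- The cost of a Steiner minimal tree for the terminal set `X`. -/
def smtCost (N : STPInstance V) (X : Finset V) : ℕ :=
  sInf {c | ∃ T : N.graph.Subgraph, N.IsSteinerTree X T ∧ N.subgraphCost T = c}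

/-- The distance `d_N(x, y)`: the least cost of a connected subgraph containing `x` and `y`. -/
def dist (N : STPInstance V) (x y : V) : ℕ :=
  sInf {c | ∃ P : N.graph.Subgraph,
    P.Connected ∧ x ∈ P.verts ∧ y ∈ P.verts ∧ N.subgraphCost P = c}

/-- The set distance `sd(A, B) = min_{x ∈ A, y ∈ B} d_N(x, y)`. -/
def setDist (N : STPInstance V) (A B : Finset V) : ℕ∞ :=
  ⨅ x ∈ A, ⨅ y ∈ B, (N.dist x y : ℕ∞)

variable [DecidableEq V]

/-- The Steiner heuristic `h` is admissible for the root `r`: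
`h(u, I) ≤ l*(u, I)` for all `u ∈ V` and `{r} ⊆ I ⊆ R`, where `l*(u, I)` is the cost of a
Steiner minimal tree for `I ∪ {u}`. -/
def Admissible (N : STPInstance V) (r : V) (h : V → Finset V → ℕ) : Prop :=
  ∀ (w : V) (I : Finset V), r ∈ I → I ⊆ N.R → h w I ≤ N.smtCost (insert w I)

/-- `R' = R \ {r}`. -/
def nonroot (N : STPInstance V) (r : V) : Finset V := N.R.erase r

end STPInstance

namespace DSStar

variable {V : Type u}

/-- The memory of the algorithm: tentative costs `l`, retracing sets `b`, the queue `Q`, the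
set `P` of expanded tuples, the upper bounds `U` (where `⊤` means undefined) and the sets `S`
used by pruning, and the number `time` of steps made so far. -/
structure State (V : Type u) where
  l : Tuple V → ℕ∞
  b : Tuple V → Finset (Tuple V)
  Q : Finset (Tuple V)
  P : Finset (Tuple V)
  U : Finset V → ℕ∞
  S : Finset V → Finset V
  time : ℕ

/-- Advance the clock by `k` steps. -/
def State.tick (s : State V) (k : ℕ) : State V := { s with time := s.time + k }

/-- Whether pruning is used. The two active variants differ in the tuple on which the pruning
test is made when the expansion of `(u, I)` lowers the cost of the adjacent tuple `(v, I)`: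
`expanded` tests `(u, I)`, `reached` tests `(v, I)`. -/
inductive Pruning where
  | off
  | expanded
  | reached

/-- `ForEach body L s s'`: the loop which executes `body` for the members of the list `L`, in
this order, can turn the state `s` into `s'`. -/
inductive ForEach {α : Type u} (body : α → State V → State V → Prop) :
    List α → State V → State V → Prop
  | nil (s : State V) : ForEach body [] s s
  | cons {a : α} {L : List α} {s s₁ s₂ : State V} :
      body a s s₁ → ForEach body L s₁ s₂ → ForEach body (a :: L) s s₂

variable [DecidableEq V]

/-! Cost model: a random access machine. One step is charged for an arithmetic operation, for a
comparison, for reading or writing an entry of a table, for inserting a tuple into `P` or `Q`,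
removing it or testing its membership, and for an evaluation of the heuristic. A Boolean operation
on sets of terminals costs `|R|` steps. -/

/-- The state before the first iteration. The clock pays for computing `R'`, for the table
of all distances `d_N` used by pruning (`|V|^3`), for `l`, `b`, `Q`, `P`, and for `U`, `S`. -/
def init [Fintype V] (N : STPInstance V) (r : V) : State V where
  l := fun p => if p.2 = ∅ ∨ (p.1 ∈ N.nonroot r ∧ p.2 = {p.1}) then 0 else ⊤
  b := fun _ => ∅
  Q := (N.nonroot r).image fun t => (t, {t})
  P := ∅
  U := fun _ => ⊤
  S := fun _ => ∅
  time := N.R.card + Fintype.card V ^ 3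
    + (2 * (Fintype.card V * 2 ^ (N.nonroot r).card)
      + (N.nonroot r).card + Fintype.card V + (N.nonroot r).card + 1)
    + 2 * 2 ^ (N.nonroot r).card

/-- The upper bound for `J` that results from the tentative cost of `(v, J)`. -/
def bound (N : STPInstance V) (s : State V) (v : V) (J : Finset V) : ℕ∞ :=
  s.l (v, J) + min (N.setDist J (N.R \ J)) (N.setDist {v} (N.R \ J))

/-- Time of a call of `prune` for the set `J`: computing `R \ J`, the two set distances by running
through all pairs, and a bounded number of table accesses and comparisons. -/
def pruneTime (N : STPInstance V) (J : Finset V) : ℕ :=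
  N.R.card + 2 * (J.card * (N.R \ J).card) + 2 * (N.R \ J).card + 8

/-- `PruneUpdate N v J s s'`: the call `prune(v, J)` turns the memory `s` into `s'`. It sets
`U(J) ← min {U(J), l(v, J) + min {sd(J, R \ J), sd({v}, R \ J)}}`; if this changes `U(J)`, then
`S(J) ← {z}` for one `z ∈ R \ J` at which the minimum is attained. -/
def PruneUpdate (N : STPInstance V) (v : V) (J : Finset V) (s s' : State V) : Prop :=
  (bound N s v J < s.U J ∧ ∃ z ∈ N.R \ J,
    min (N.setDist J {z}) (N.setDist {v} {z})
      = min (N.setDist J (N.R \ J)) (N.setDist {v} (N.R \ J)) ∧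
    s' = { s with
      U := Function.update s.U J (bound N s v J)
      S := Function.update s.S J {z}
      time := s.time + pruneTime N J }) ∨
  (s.U J ≤ bound N s v J ∧ s' = s.tick (pruneTime N J))

/-- The answer of `prune(v, J)`: the tentative cost of `(v, J)` exceeds the upper bound. -/
def Exceeds (s : State V) (v : V) (J : Finset V) : Prop := s.U J < s.l (v, J)

open Classical in
/-- The combination of the upper bounds for `I` and `J` at the start of `prune_combine`. -/
def combine (N : STPInstance V) (I J : Finset V) (s : State V) : State V :=
  if s.U I ≠ ⊤ ∧ s.U J ≠ ⊤ ∧ (s.S I ∩ J = ∅ ∨ s.S J ∩ I = ∅) then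
    { s with
      U := Function.update s.U (I ∪ J) (s.U I + s.U J)
      S := Function.update s.S (I ∪ J) ((s.S I ∪ s.S J) \ (I ∪ J))
      time := s.time + (6 * N.R.card + 9) }
  else s.tick (6 * N.R.card + 9)

/-- `Q ← Q ∪ {p}`. -/
def push (p : Tuple V) (s : State V) : State V :=
  { s with Q := insert p s.Q, time := s.time + 1 }

open Classical in
/-- `if not c then Q ← Q ∪ {p}`. -/
def pushUnless (c : Prop) (p : Tuple V) (s : State V) : State V :=
  if c then s.tick 1 else push p s

/-- `l(p) ← c; b(p) ← B`. -/
def relabel (p : Tuple V) (c : ℕ∞) (B : Finset (Tuple V)) (s : State V) : State V :=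
  { s with
    l := Function.update s.l p c
    b := Function.update s.b p B
    time := s.time + 2 }

/-- The body of the loop over `∅ ≠ J ⊆ R' \ I` with `(u, J) ∈ P` when `(u, I)` is expanded.
The loop enumerates all subsets of `R' \ I` and skips those which do not qualify. -/
inductive MergeBody (N : STPInstance V) (mode : Pruning) (w : V) (I : Finset V) :
    Finset V → State V → State V → Prop
  | skip (J : Finset V) (s : State V) (hJ : J = ∅ ∨ (w, J) ∉ s.P) :
      MergeBody N mode w I J s (s.tick (N.R.card + 2))
  | keep (J : Finset V) (s : State V) (hJ : J ≠ ∅ ∧ (w, J) ∈ s.P)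
      (hl : s.l (w, I ∪ J) ≤ s.l (w, I) + s.l (w, J)) :
      MergeBody N mode w I J s (s.tick (2 * N.R.card + 7))
  | improve (J : Finset V) (s s₁ : State V) (hJ : J ≠ ∅ ∧ (w, J) ∈ s.P)
      (hl : s.l (w, I) + s.l (w, J) < s.l (w, I ∪ J))
      (hs₁ : s₁ = relabel (w, I ∪ J) (s.l (w, I) + s.l (w, J)) {(w, I), (w, J)}
        (s.tick (2 * N.R.card + 7)))
      (hoff : mode = Pruning.off) :
      MergeBody N mode w I J s (push (w, I ∪ J) s₁)
  | improvePrune (J : Finset V) (s s₁ s₂ : State V) (hJ : J ≠ ∅ ∧ (w, J) ∈ s.P)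
      (hl : s.l (w, I) + s.l (w, J) < s.l (w, I ∪ J))
      (hs₁ : s₁ = relabel (w, I ∪ J) (s.l (w, I) + s.l (w, J)) {(w, I), (w, J)}
        (s.tick (2 * N.R.card + 7)))
      (hon : mode ≠ Pruning.off)
      (hs₂ : PruneUpdate N w (I ∪ J) (combine N I J s₁) s₂) :
      MergeBody N mode w I J s (pushUnless (Exceeds s₂ w (I ∪ J)) (w, I ∪ J) s₂)

/-- The body of the loop over the edges `{u, v}` incident to `u` when `(u, I)` is expanded. -/
inductive EdgeBody (N : STPInstance V) (mode : Pruning) (w : V) (I : Finset V) :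
    V → State V → State V → Prop
  | keep (v : V) (s : State V) (hl : s.l (v, I) ≤ s.l (w, I) + N.cost s(w, v)) :
      EdgeBody N mode w I v s (s.tick 6)
  | improve (v : V) (s s₁ : State V) (hl : s.l (w, I) + N.cost s(w, v) < s.l (v, I))
      (hs₁ : s₁ = relabel (v, I) (s.l (w, I) + N.cost s(w, v)) {(w, I)} (s.tick 6))
      (hoff : mode = Pruning.off) :
      EdgeBody N mode w I v s (push (v, I) s₁)
  | improvePruneExpanded (v : V) (s s₁ s₂ : State V)
      (hl : s.l (w, I) + N.cost s(w, v) < s.l (v, I))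
      (hs₁ : s₁ = relabel (v, I) (s.l (w, I) + N.cost s(w, v)) {(w, I)} (s.tick 6))
      (hon : mode = Pruning.expanded)
      (hs₂ : PruneUpdate N w I s₁ s₂) :
      EdgeBody N mode w I v s (pushUnless (Exceeds s₂ w I) (v, I) s₂)
  | improvePruneReached (v : V) (s s₁ s₂ : State V)
      (hl : s.l (w, I) + N.cost s(w, v) < s.l (v, I))
      (hs₁ : s₁ = relabel (v, I) (s.l (w, I) + N.cost s(w, v)) {(w, I)} (s.tick 6))
      (hon : mode = Pruning.reached)
      (hs₂ : PruneUpdate N v I s₁ s₂) :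
      EdgeBody N mode w I v s (pushUnless (Exceeds s₂ v I) (v, I) s₂)

/-- The value `l(u, I) + h(u, R \ I)` that is minimized over the queue. -/
def key (N : STPInstance V) (h : V → Finset V → ℕ) (s : State V) (p : Tuple V) : ℕ∞ :=
  s.l p + h p.1 (N.R \ p.2)

/-- Moving the selected tuple from `Q` to `P`. The clock pays for the test of the loop condition,
for a scan of the whole queue, for the two updates and for computing `R' \ I`. -/
def select (N : STPInstance V) (p : Tuple V) (s : State V) : State V :=
  { s with
    Q := s.Q.erase p
    P := insert p s.P
    time := s.time + (1 + s.Q.card * (N.R.card + 4) + 2 + N.R.card) }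

/-- One iteration of the main loop. Ties in the selection and the orders in which the two inner
loops run through their ranges are arbitrary. -/
def Iteration (N : STPInstance V) (r : V) (h : V → Finset V → ℕ) (mode : Pruning)
    (s s' : State V) : Prop :=
  ∃ (w : V) (I : Finset V), (w, I) ∈ s.Q ∧ (∀ q ∈ s.Q, key N h s (w, I) ≤ key N h s q) ∧
    ∃ (Js : List (Finset V)) (vs : List V),
      Js.Nodup ∧ (∀ J, J ∈ Js ↔ J ⊆ N.nonroot r \ I) ∧
      vs.Nodup ∧ (∀ v, v ∈ vs ↔ N.graph.Adj w v) ∧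
      ∃ s₁, ForEach (MergeBody N mode w I) Js (select N (w, I) s) s₁ ∧
        ForEach (EdgeBody N mode w I) vs s₁ s'

/-- The goal `(r, R')` has been expanded. -/
def Reached (N : STPInstance V) (r : V) (s : State V) : Prop := (r, N.nonroot r) ∈ s.P

/-- The main loop ends: the goal has been expanded, or there is no tuple left to select. -/
def Halted (N : STPInstance V) (r : V) (s : State V) : Prop := Reached N r s ∨ s.Q = ∅

/-- An execution of the main loop, given by the states after `0, 1, 2, …` iterations; it stays
constant once the loop has ended. -/
def IsExecution [Fintype V] (N : STPInstance V) (r : V) (h : V → Finset V → ℕ) (mode : Pruning)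
    (x : ℕ → State V) : Prop :=
  x 0 = init N r ∧ ∀ i, (Halted N r (x i) ∧ x (i + 1) = x i) ∨
    (¬ Halted N r (x i) ∧ Iteration N r h mode (x i) (x (i + 1)))

/-- `Retrace b p E t`: the recursive procedure
`computeSMT(u, I) = ⋃_{(u', I') ∈ b(u, I)} computeSMT(u', I') ∪ {{u, u'} | u ≠ u'}`,
called for `p = (u, I)`, ends after `t` steps and returns the edge set `E`. -/
inductive Retrace (b : Tuple V → Finset (Tuple V)) : Tuple V → Finset (Sym2 V) → ℕ → Prop
  | call (p : Tuple V) (E : Tuple V → Finset (Sym2 V)) (t : Tuple V → ℕ)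
      (hrec : ∀ q ∈ b p, Retrace b q (E q) (t q)) :
      Retrace b p
        ((b p).biUnion fun q => E q ∪ if p.1 = q.1 then ∅ else {s(p.1, q.1)})
        (1 + ∑ q ∈ b p, (t q + (E q).card + 3))

/-- The DS* algorithm for the instance `N`, the root `r` and the heuristic `h` ends after at most
`T` steps, whatever its choices. If there is a terminal besides the root, the main loop ends because
the goal has been expanded, not for lack of tuples. The last summands of the running time pay for
retracing the tree and for returning its vertices, edges, root and cost. -/
def RunsInTime [Fintype V] (N : STPInstance V) (r : V) (h : V → Finset V → ℕ) (mode : Pruning)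
    (T : ℕ) : Prop :=
  ∀ x : ℕ → State V, IsExecution N r h mode x →
    ∃ i, Halted N r (x i) ∧ (N.R ≠ {r} → Reached N r (x i)) ∧
      ∃ (E : Finset (Sym2 V)) (t : ℕ), Retrace (x i).b (r, N.nonroot r) E t ∧
        (x i).time + t + (3 * E.card + 3) ≤ T

end DSStar

end

/-! The heuristic need not be consistent, so a tuple may be expanded many times; positivity of the
edge costs limits this. When `(v, K)` is expanded, its key is minimal, so every queued `(q, K)`
whose heuristic value is at most that of `v` has a label no smaller than `l (v, K)`, and expanding
such a tuple creates only strictly larger labels in layer `K`. Hence `(v, K)` can return to the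
queue only after an expansion of some `(q, K)` with larger heuristic value, or of a tuple whose set
is a proper subset of `K` (`Count.step`). If the latter number `c - 1`, then adding the vertices by
decreasing heuristic value at most doubles the running total plus `c`, so layer `K` has fewer than
`2 ^ |V| * c` expansions (`sum_add_le_of_le_higher`). Induction on `|K|` bounds the number of all
expansions by `2 ^ (j + (|V| + j) * j)`, where `j = |R| - 1` (`Count.total_le`), and each costs at
most `71 * |R| * |V| * 2 ^ j` steps.

Pruning must not exhaust the queue before the goal is expanded. All finite labels and upper bounds
are backed by actual edge sets (`Sound`). If `(v, I)` is good, then replacing the `I`-part of an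
optimal tree by the edges behind `U I` still connects `R`; so `U I` is at least the optimal label
(`BoundSound.le`), and a good tuple whose label becomes optimal is queued. Once the queue is empty,
every optimal good tuple has been propagated, and the Dreyfus–Wagner recursion (`dreyfusWagner`)
shows that all good tuples are optimal, among them `(r, R')`.

For retracing, a pointer either leads to a smaller label with the same terminal set or splits this
set. So there are at most `2 * j * |V|` calls, and retracing takes quadratic time in this number
(`exists_retrace`). -/

noncomputable section

set_option linter.unusedSectionVars false

/-! ### Edge sets in place of Steiner trees -/

namespace STPInstance

variable {V : Type u} [DecidableEq V] (N : STPInstance V)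

/-- The total cost of a finite set of edges. -/
def edgeCost (F : Finset (Sym2 V)) : ℕ := ∑ e ∈ F, N.cost e

/-- The edge set `F` connects `v` to every member of `I`. -/
def Joins (F : Finset (Sym2 V)) (v : V) (I : Finset V) : Prop :=
  ∀ x ∈ I, (SimpleGraph.fromEdgeSet (F : Set (Sym2 V))).Reachable v x

/-- The edges of `F` are edges of the network. -/
def EdgesOf (F : Finset (Sym2 V)) : Prop := (F : Set (Sym2 V)) ⊆ N.graph.edgeSet

/-- The cost `l*(v, I)` of a Steiner minimal tree for `I ∪ {v}`. -/
def treeCost (v : V) (I : Finset V) : ℕ := N.smtCost (insert v I)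

variable {N}

theorem reachable_mono {F F' : Finset (Sym2 V)} (h : F ⊆ F') {x y : V}
    (hxy : (SimpleGraph.fromEdgeSet (F : Set (Sym2 V))).Reachable x y) :
    (SimpleGraph.fromEdgeSet (F' : Set (Sym2 V))).Reachable x y :=
  hxy.mono (SimpleGraph.fromEdgeSet_mono (by exact_mod_cast h))

theorem Joins.mono {F F' : Finset (Sym2 V)} (h : F ⊆ F') {v : V} {I : Finset V}
    (hF : Joins F v I) : Joins F' v I := fun x hx => reachable_mono h (hF x hx)

theorem edgeCost_union_le (F F' : Finset (Sym2 V)) :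
    N.edgeCost (F ∪ F') ≤ N.edgeCost F + N.edgeCost F' := by
  unfold edgeCost
  rw [← Finset.sum_union_inter]
  exact Nat.le_add_right _ _

theorem EdgesOf.union {F F' : Finset (Sym2 V)} (h : N.EdgesOf F) (h' : N.EdgesOf F') :
    N.EdgesOf (F ∪ F') := by
  unfold EdgesOf
  rw [Finset.coe_union]
  exact Set.union_subset h h'

theorem EdgesOf.mono {F F' : Finset (Sym2 V)} (h : F ⊆ F') (h' : N.EdgesOf F') : N.EdgesOf F :=
  fun _ he => h' (h he)

/-- A spanning tree of the component of `v` in `F`. It permits working with arbitrary edge sets,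
whose unions need not be trees. -/
theorem exists_steinerTree {F : Finset (Sym2 V)} (hF : N.EdgesOf F) {v : V} {I : Finset V}
    (hj : Joins F v I) :
    ∃ T : N.graph.Subgraph, N.IsSteinerTree (insert v I) T ∧ T.edgeSet ⊆ F := by
  set G := SimpleGraph.fromEdgeSet (F : Set (Sym2 V)) with hG
  set c := G.connectedComponentMk v with hc
  obtain ⟨T, hT, htree⟩ := c.connected_toSimpleGraph.exists_isTree_le
  have hle : G ≤ N.graph := by
    intro a b hab
    exact hF ((SimpleGraph.fromEdgeSet_adj _).1 hab).1
  have hTG : ∀ a b, T.Adj a b → G.Adj a.1 b.1 := fun a b h => hT h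
  let K : N.graph.Subgraph :=
    { verts := c.supp
      Adj := fun a b => ∃ (ha : a ∈ c.supp) (hb : b ∈ c.supp), T.Adj ⟨a, ha⟩ ⟨b, hb⟩
      adj_sub := fun ⟨_, _, h⟩ => hle (hTG _ _ h)
      edge_vert := fun ⟨ha, _, _⟩ => ha
      symm := ⟨fun _ _ ⟨ha, hb, h⟩ => ⟨hb, ha, h.symm⟩⟩ }
  refine ⟨K, ⟨?_, ?_⟩, ?_⟩
  · intro x hx
    rcases Finset.mem_insert.1 (Finset.mem_coe.1 hx) with rfl | hx
    · exact (SimpleGraph.ConnectedComponent.mem_supp_iff _ _).2 rfl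
    · exact (SimpleGraph.ConnectedComponent.mem_supp_iff _ _).2
        (SimpleGraph.ConnectedComponent.sound (hj x hx).symm)
  · have : K.coe = T := by
      ext a b
      exact ⟨fun ⟨_, _, h⟩ => h, fun h => ⟨a.2, b.2, h⟩⟩
    rw [this]
    exact htree
  · intro e
    induction e using Sym2.ind with
    | _ a b =>
      rintro ⟨ha, hb, h⟩
      exact ((SimpleGraph.fromEdgeSet_adj _).1 (hTG _ _ h)).1

theorem subgraphCost_le [Fintype V] {F : Finset (Sym2 V)} {T : N.graph.Subgraph}
    (h : T.edgeSet ⊆ F) : N.subgraphCost T ≤ N.edgeCost F := by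
  unfold subgraphCost edgeCost
  rw [finsum_mem_eq_finite_toFinset_sum _ (Set.toFinite T.edgeSet)]
  exact Finset.sum_le_sum_of_subset fun e he => h (by simpa using he)

theorem treeCost_le [Fintype V] {F : Finset (Sym2 V)} (hF : N.EdgesOf F) {v : V} {I : Finset V}
    (hj : Joins F v I) : N.treeCost v I ≤ N.edgeCost F := by
  obtain ⟨T, hT, hTF⟩ := exists_steinerTree hF hj
  exact le_trans (Nat.sInf_le ⟨T, hT, rfl⟩) (subgraphCost_le hTF)

theorem exists_edges_of_subgraph [Fintype V] (H : N.graph.Subgraph) (hH : H.Connected) :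
    ∃ F, N.EdgesOf F ∧ N.edgeCost F = N.subgraphCost H ∧ ∀ x ∈ H.verts, ∀ y ∈ H.verts,
      (SimpleGraph.fromEdgeSet (F : Set (Sym2 V))).Reachable x y := by
  refine ⟨(Set.toFinite H.edgeSet).toFinset, ?_, ?_, ?_⟩
  · intro e he
    exact H.edgeSet_subset (by simpa using he)
  · unfold subgraphCost edgeCost
    rw [finsum_mem_eq_finite_toFinset_sum _ (Set.toFinite H.edgeSet)]
  · intro x hx y hy
    have h := hH.coe.preconnected ⟨x, hx⟩ ⟨y, hy⟩
    let f : H.coe →g SimpleGraph.fromEdgeSet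
        (((Set.toFinite H.edgeSet).toFinset : Finset (Sym2 V)) : Set (Sym2 V)) :=
      ⟨Subtype.val, fun {a b} hab => (SimpleGraph.fromEdgeSet_adj _).2
        ⟨by simpa using hab, fun h => hab.ne (Subtype.ext h)⟩⟩
    exact h.map f

theorem exists_joins [Fintype V] (v : V) (I : Finset V) :
    ∃ F, N.EdgesOf F ∧ Joins F v I ∧ N.edgeCost F = N.treeCost v I := by
  -- Since `sInf ∅ = 0`, the minimum is attained only if some Steiner tree exists; connectedness of
  -- the network provides one.
  have hne : {c | ∃ T : N.graph.Subgraph, N.IsSteinerTree (insert v I) T ∧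
      N.subgraphCost T = c}.Nonempty := by
    have hF : N.EdgesOf (Set.toFinite N.graph.edgeSet).toFinset := by simp [EdgesOf]
    obtain ⟨T, hT, -⟩ := exists_steinerTree (v := v) (I := I) hF (by
      intro x _
      simpa using N.connected.preconnected v x)
    exact ⟨_, T, hT, rfl⟩
  obtain ⟨T, hT, hc⟩ := Nat.sInf_mem hne
  obtain ⟨F, hF, hFc, hr⟩ := exists_edges_of_subgraph T (SimpleGraph.Subgraph.connected_iff'.2 hT.2.1)
  exact ⟨F, hF, fun x hx => hr v (hT.1 (by simp)) x (hT.1 (by simp [hx])), hFc.trans hc⟩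

theorem exists_path [Fintype V] (x y : V) :
    ∃ F, N.EdgesOf F ∧ (SimpleGraph.fromEdgeSet (F : Set (Sym2 V))).Reachable x y ∧
      N.edgeCost F = N.dist x y := by
  have hne : {c | ∃ P : N.graph.Subgraph,
      P.Connected ∧ x ∈ P.verts ∧ y ∈ P.verts ∧ N.subgraphCost P = c}.Nonempty :=
    ⟨_, ⊤, SimpleGraph.Subgraph.connected_iff'.2
      (SimpleGraph.Subgraph.topIso.connected_iff.2 N.connected), trivial, trivial, rfl⟩
  obtain ⟨P, hP, hx, hy, hc⟩ := Nat.sInf_mem hne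
  obtain ⟨F, hF, hFc, hr⟩ := exists_edges_of_subgraph P hP
  exact ⟨F, hF, hr x hx y hy, hFc.trans hc⟩

/-! ### The Dreyfus–Wagner recursion -/

theorem treeCost_singleton [Fintype V] (v : V) : N.treeCost v {v} = 0 := by
  have := treeCost_le (N := N) (F := ∅) (v := v) (I := {v}) (by simp [EdgesOf]) (by
    intro x hx
    rw [Finset.mem_singleton.1 hx])
  simpa [edgeCost] using this

/-- Removing an edge at `v` leaves every vertex of the component of `v` connected to one of its
ends. -/
theorem reachable_erase {F : Finset (Sym2 V)} {v w x : V}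
    (h : (SimpleGraph.fromEdgeSet (F : Set (Sym2 V))).Reachable v x) :
    (SimpleGraph.fromEdgeSet ((F.erase s(v, w) : Finset _) : Set (Sym2 V))).Reachable v x ∨
      (SimpleGraph.fromEdgeSet ((F.erase s(v, w) : Finset _) : Set (Sym2 V))).Reachable w x := by
  rw [SimpleGraph.reachable_iff_reflTransGen] at h
  induction h with
  | refl => exact Or.inl (SimpleGraph.Reachable.refl _)
  | @tail a b _ hab ih =>
    obtain ⟨hab, hne⟩ := (SimpleGraph.fromEdgeSet_adj _).1 hab
    by_cases he : s(a, b) = s(v, w)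
    · rcases Sym2.eq_iff.1 he with ⟨-, rfl⟩ | ⟨-, rfl⟩
      · exact Or.inr (SimpleGraph.Reachable.refl _)
      · exact Or.inl (SimpleGraph.Reachable.refl _)
    · have hadj : (SimpleGraph.fromEdgeSet
          ((F.erase s(v, w) : Finset _) : Set (Sym2 V))).Adj a b := by
        rw [SimpleGraph.fromEdgeSet_adj]
        exact ⟨by simpa [he] using hab, hne⟩
      exact ih.imp (fun h => h.trans hadj.reachable) (fun h => h.trans hadj.reachable)

open Classical in
/-- The edges of `F` with an end in the component of `v`. -/
def componentEdges (F : Finset (Sym2 V)) (v : V) : Finset (Sym2 V) :=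
  F.filter fun e => ∃ x ∈ e, (SimpleGraph.fromEdgeSet (F : Set (Sym2 V))).Reachable v x

theorem componentEdges_subset (F : Finset (Sym2 V)) (v : V) : componentEdges F v ⊆ F := by
  intro e he
  simp only [componentEdges, Finset.mem_filter] at he
  exact he.1

theorem reachable_componentEdges {F : Finset (Sym2 V)} {v x : V}
    (h : (SimpleGraph.fromEdgeSet (F : Set (Sym2 V))).Reachable v x) :
    (SimpleGraph.fromEdgeSet (componentEdges F v : Set (Sym2 V))).Reachable v x := by
  have h' := h
  rw [SimpleGraph.reachable_iff_reflTransGen] at h'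
  induction h' with
  | refl => exact SimpleGraph.Reachable.refl _
  | @tail a b ha hab ih =>
    rw [← SimpleGraph.reachable_iff_reflTransGen] at ha
    obtain ⟨hab', hne⟩ := (SimpleGraph.fromEdgeSet_adj _).1 hab
    refine (ih ha).trans (SimpleGraph.Adj.reachable ?_)
    rw [SimpleGraph.fromEdgeSet_adj]
    refine ⟨?_, hne⟩
    simp only [componentEdges, Finset.coe_filter, Set.mem_ofPred_eq]
    exact ⟨hab', a, by simp, ha⟩

theorem disjoint_componentEdges {F : Finset (Sym2 V)} {v w : V}
    (h : ¬ (SimpleGraph.fromEdgeSet (F : Set (Sym2 V))).Reachable v w) :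
    Disjoint (componentEdges F v) (componentEdges F w) := by
  rw [Finset.disjoint_left]
  intro e he he'
  simp only [componentEdges, Finset.mem_filter] at he he'
  obtain ⟨heF, x, hx, hvx⟩ := he
  obtain ⟨-, y, hy, hwy⟩ := he'
  apply h
  by_cases hxy : x = y
  · subst hxy
    exact hvx.trans hwy.symm
  · have : e = s(x, y) := (Sym2.mem_and_mem_iff hxy).1 ⟨hx, hy⟩
    have hadj : (SimpleGraph.fromEdgeSet (F : Set (Sym2 V))).Adj x y := by
      rw [SimpleGraph.fromEdgeSet_adj]
      exact ⟨by rw [← this]; exact heF, hxy⟩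
    exact (hvx.trans hadj.reachable).trans hwy.symm

/-- If `v ∈ I`, the set `{v}` splits off at no cost. Otherwise delete an edge `{v, w}` from a
cheapest edge set joining `v` to `I`. By optimality the rest does not join `v` to `I`, so `v` and
`w` are separated and the terminals divide between their components. If all lie with `w`, the edge
is a step from `w`; if not, the two components give the partition. -/
theorem dreyfusWagner [Fintype V] (v : V) {I : Finset V} (hI : I.Nonempty) (hv : I ≠ {v}) :
    (∃ w, N.graph.Adj w v ∧ N.treeCost w I + N.cost s(w, v) ≤ N.treeCost v I) ∨
    (∃ I₁ I₂ : Finset V, I₁.Nonempty ∧ I₂.Nonempty ∧ Disjoint I₁ I₂ ∧ I₁ ∪ I₂ = I ∧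
      N.treeCost v I₁ + N.treeCost v I₂ ≤ N.treeCost v I) := by
  by_cases hvI : v ∈ I
  · right
    refine ⟨I.erase v, {v}, ?_, by simp, by simp, ?_, ?_⟩
    · rw [Finset.nonempty_iff_ne_empty]
      intro h
      rw [Finset.erase_eq_empty_iff] at h
      rcases h with h | h
      · simp [h] at hI
      · exact hv h
    · ext x
      by_cases hx : x = v <;> simp [hx, hvI]
    · rw [treeCost_singleton]
      simp [treeCost, hvI]
  obtain ⟨F, hF, hj, hc⟩ := exists_joins (N := N) v I
  obtain ⟨x, hx⟩ := hI
  have hvx : v ≠ x := fun h => hvI (h ▸ hx)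
  obtain ⟨w, hw⟩ : ∃ w, (SimpleGraph.fromEdgeSet (F : Set (Sym2 V))).Adj v w := by
    have h := hj x hx
    rw [SimpleGraph.reachable_iff_reflTransGen] at h
    rcases h.cases_head with h | ⟨w, hw, -⟩
    · exact absurd h hvx
    · exact ⟨w, hw⟩
  have he : s(v, w) ∈ F := by
    simpa using ((SimpleGraph.fromEdgeSet_adj _).1 hw).1
  have hadj : N.graph.Adj v w := hF he
  have hpos : 0 < N.cost s(v, w) := N.cost_pos _ hadj
  set F' := F.erase s(v, w) with hF'
  have hFE : N.EdgesOf F' := EdgesOf.mono (Finset.erase_subset _ _) hF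
  have hcost : N.edgeCost F' + N.cost s(v, w) = N.edgeCost F := Finset.sum_erase_add _ _ he
  set G' := SimpleGraph.fromEdgeSet (F' : Set (Sym2 V)) with hG'
  have hsplit : ∀ x ∈ I, G'.Reachable v x ∨ G'.Reachable w x :=
    fun x hx => reachable_erase (hj x hx)
  have hnot : ¬ Joins F' v I := fun h => by
    have := treeCost_le hFE h
    omega
  have hvw : ¬ G'.Reachable v w := fun h => hnot fun x hx =>
    (hsplit x hx).elim id fun h' => h.trans h'
  classical
  set I₁ := I.filter fun x => G'.Reachable v x with hI₁
  set I₂ := I.filter fun x => G'.Reachable w x with hI₂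
  have hun : I₁ ∪ I₂ = I := by
    ext y
    simp only [hI₁, hI₂, Finset.mem_union, Finset.mem_filter]
    constructor
    · rintro (h | h) <;> exact h.1
    · intro h
      exact (hsplit y h).imp (fun h' => ⟨h, h'⟩) (fun h' => ⟨h, h'⟩)
  have hdisj : Disjoint I₁ I₂ := by
    rw [Finset.disjoint_left]
    intro y hy hy'
    exact hvw ((Finset.mem_filter.1 hy).2.trans (Finset.mem_filter.1 hy').2.symm)
  have hne₂ : I₂.Nonempty := by
    rw [Finset.nonempty_iff_ne_empty]
    intro h
    rw [h, Finset.union_empty] at hun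
    refine hnot fun y hy => ?_
    rw [← hun] at hy
    exact (Finset.mem_filter.1 hy).2
  rcases I₁.eq_empty_or_nonempty with h₁ | hne₁
  · left
    refine ⟨w, hadj.symm, ?_⟩
    rw [h₁, Finset.empty_union] at hun
    have := treeCost_le (v := w) (I := I) hFE (by
      intro y hy
      rw [← hun] at hy
      exact (Finset.mem_filter.1 hy).2)
    rw [Sym2.eq_swap]
    omega
  · right
    refine ⟨I₁, I₂, hne₁, hne₂, hdisj, hun, ?_⟩
    have hs₁ : componentEdges F' v ⊆ F' := componentEdges_subset _ _
    have hs₂ : componentEdges F' w ⊆ F' := componentEdges_subset _ _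
    have c₁ := treeCost_le (v := v) (I := I₁) (EdgesOf.mono hs₁ hFE) (by
      intro y hy
      exact reachable_componentEdges (Finset.mem_filter.1 hy).2)
    -- The deleted edge is charged to the side of `w` alone.
    have c₂ := treeCost_le (N := N) (v := v) (I := I₂)
      (F := insert s(v, w) (componentEdges F' w)) (by
        intro e he'
        rcases Finset.mem_insert.1 (Finset.mem_coe.1 he') with rfl | h
        · exact hadj
        · exact hFE (hs₂ h)) (by
      intro y hy
      refine SimpleGraph.Reachable.trans (v := w) (SimpleGraph.Adj.reachable ?_)
        (reachable_mono (Finset.subset_insert _ _)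
          (reachable_componentEdges (Finset.mem_filter.1 hy).2))
      rw [SimpleGraph.fromEdgeSet_adj]
      exact ⟨by simp, hadj.ne⟩)
    have c₃ : N.edgeCost (insert s(v, w) (componentEdges F' w)) ≤
        N.cost s(v, w) + N.edgeCost (componentEdges F' w) := by
      unfold edgeCost
      rw [Finset.sum_insert (fun h => by simpa [hF'] using hs₂ h)]
    have c₄ : N.edgeCost (componentEdges F' v) + N.edgeCost (componentEdges F' w) ≤
        N.edgeCost F' := by
      unfold edgeCost
      rw [← Finset.sum_union (disjoint_componentEdges hvw)]
      exact Finset.sum_le_sum_of_subset (Finset.union_subset hs₁ hs₂)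
    omega

end STPInstance

/-! ### Effect of one loop body on the memory -/

namespace DSStar

open STPInstance

variable {V : Type u} [DecidableEq V] {N : STPInstance V}

/-- The two states differ in their clocks only. -/
def Same (s s' : State V) : Prop :=
  s'.l = s.l ∧ s'.b = s.b ∧ s'.Q = s.Q ∧ s'.P = s.P ∧ s'.U = s.U ∧ s'.S = s.S

/-- The cost of `p` is lowered to `c`, and `p` enters the queue unless it is pruned. -/
def Lowered (p : Tuple V) (c : ℕ∞) (B : Finset (Tuple V)) (s s' : State V) : Prop :=
  c < s.l p ∧ s'.l = Function.update s.l p c ∧ s'.b = Function.update s.b p B ∧ s'.P = s.P ∧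
    (s'.Q = insert p s.Q ∨ (s'.Q = s.Q ∧ s'.U p.2 < c))

theorem PruneUpdate.frame {v : V} {J : Finset V} {s s' : State V} (h : PruneUpdate N v J s s') :
    s'.l = s.l ∧ s'.b = s.b ∧ s'.Q = s.Q ∧ s'.P = s.P ∧ s'.time = s.time + pruneTime N J := by
  rcases h with ⟨-, z, -, -, rfl⟩ | ⟨-, rfl⟩
  · exact ⟨rfl, rfl, rfl, rfl, rfl⟩
  · exact ⟨rfl, rfl, rfl, rfl, rfl⟩

theorem combine_frame (I J : Finset V) (s : State V) :
    (combine N I J s).l = s.l ∧ (combine N I J s).b = s.b ∧ (combine N I J s).Q = s.Q ∧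
      (combine N I J s).P = s.P ∧ (combine N I J s).time = s.time + (6 * N.R.card + 9) := by
  unfold combine
  split_ifs
  · exact ⟨rfl, rfl, rfl, rfl, rfl⟩
  · exact ⟨rfl, rfl, rfl, rfl, rfl⟩

theorem pushUnless_frame (c : Prop) (p : Tuple V) (s : State V) :
    (pushUnless c p s).l = s.l ∧ (pushUnless c p s).b = s.b ∧ (pushUnless c p s).P = s.P ∧
      (pushUnless c p s).U = s.U ∧ (pushUnless c p s).S = s.S ∧
      (pushUnless c p s).time = s.time + 1 ∧
      ((pushUnless c p s).Q = insert p s.Q ∨ ((pushUnless c p s).Q = s.Q ∧ c)) := by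
  unfold pushUnless
  split_ifs with h
  · exact ⟨rfl, rfl, rfl, rfl, rfl, rfl, Or.inr ⟨rfl, h⟩⟩
  · exact ⟨rfl, rfl, rfl, rfl, rfl, rfl, Or.inl rfl⟩

theorem same_tick (s : State V) (k : ℕ) : Same s (s.tick k) := ⟨rfl, rfl, rfl, rfl, rfl, rfl⟩

/-- Abstracts from the pruning variant: for labels and queue it only matters that an omitted tuple
has a new label above its upper bound. -/
theorem MergeBody.effect {mode : Pruning} {w : V} {I J : Finset V} {s s' : State V}
    (h : MergeBody N mode w I J s s') :
    (Same s s' ∧ (J = ∅ ∨ (w, J) ∉ s.P ∨ s.l (w, I ∪ J) ≤ s.l (w, I) + s.l (w, J))) ∨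
    (J ≠ ∅ ∧ (w, J) ∈ s.P ∧
      Lowered (w, I ∪ J) (s.l (w, I) + s.l (w, J)) {(w, I), (w, J)} s s') := by
  cases h with
  | skip hJ => exact Or.inl ⟨same_tick _ _, hJ.elim Or.inl fun h => Or.inr (Or.inl h)⟩
  | keep hJ hl => exact Or.inl ⟨same_tick _ _, Or.inr (Or.inr hl)⟩
  | improve s₁ hJ hl hs₁ hoff =>
    subst hs₁
    exact Or.inr ⟨hJ.1, hJ.2, hl, rfl, rfl, rfl, Or.inl rfl⟩
  | improvePrune s₁ s₂ hJ hl hs₁ hon hs₂ =>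
    subst hs₁
    obtain ⟨l₂, b₂, q₂, p₂, -⟩ := hs₂.frame
    obtain ⟨l₁, b₁, q₁, p₁, -⟩ := combine_frame (N := N) I J
      (relabel (w, I ∪ J) (s.l (w, I) + s.l (w, J)) {(w, I), (w, J)}
        (s.tick (2 * N.R.card + 7)))
    obtain ⟨l₃, b₃, p₃, u₃, -, -, q₃⟩ := pushUnless_frame
      (Exceeds s₂ w (I ∪ J)) (w, I ∪ J) s₂
    have hl2 : s₂.l = Function.update s.l (w, I ∪ J) (s.l (w, I) + s.l (w, J)) := l₂.trans l₁
    have hq2 : s₂.Q = s.Q := q₂.trans q₁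
    refine Or.inr ⟨hJ.1, hJ.2, hl, l₃.trans hl2, b₃.trans (b₂.trans b₁),
      p₃.trans (p₂.trans p₁), ?_⟩
    rw [hq2] at q₃
    refine q₃.imp id fun ⟨hq, hex⟩ => ⟨hq, ?_⟩
    unfold Exceeds at hex
    rw [hl2, Function.update_self] at hex
    rw [u₃]
    exact hex

theorem EdgeBody.effect {mode : Pruning} {w v : V} {I : Finset V} {s s' : State V}
    (hvw : v ≠ w) (h : EdgeBody N mode w I v s s') :
    (Same s s' ∧ s.l (v, I) ≤ s.l (w, I) + N.cost s(w, v)) ∨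
      Lowered (v, I) (s.l (w, I) + N.cost s(w, v)) {(w, I)} s s' := by
  cases h with
  | keep hl => exact Or.inl ⟨same_tick _ _, hl⟩
  | improve s₁ hl hs₁ hoff =>
    subst hs₁
    exact Or.inr ⟨hl, rfl, rfl, rfl, Or.inl rfl⟩
  | improvePruneExpanded s₁ s₂ hl hs₁ hon hs₂ =>
    subst hs₁
    obtain ⟨l₂, b₂, q₂, p₂, -⟩ := hs₂.frame
    obtain ⟨l₃, b₃, p₃, u₃, -, -, q₃⟩ := pushUnless_frame (Exceeds s₂ w I) (v, I) s₂
    rw [q₂] at q₃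
    refine Or.inr ⟨hl, l₃.trans l₂, b₃.trans b₂, p₃.trans p₂,
      q₃.imp id fun ⟨hq, hex⟩ => ⟨hq, ?_⟩⟩
    unfold Exceeds at hex
    rw [l₂] at hex
    -- In this variant the test concerns the label of `(w, I)`, which relabelling `(v, I)` does not
    -- touch and which is at most the new label of `(v, I)`.
    have : (w, I) ≠ (v, I) := fun h => hvw (Prod.ext_iff.1 h).1.symm
    simp only [relabel, State.tick, Function.update_of_ne this] at hex
    rw [u₃]
    exact lt_of_lt_of_le hex le_self_add
  | improvePruneReached s₁ s₂ hl hs₁ hon hs₂ =>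
    subst hs₁
    obtain ⟨l₂, b₂, q₂, p₂, -⟩ := hs₂.frame
    obtain ⟨l₃, b₃, p₃, u₃, -, -, q₃⟩ := pushUnless_frame (Exceeds s₂ v I) (v, I) s₂
    rw [q₂] at q₃
    refine Or.inr ⟨hl, l₃.trans l₂, b₃.trans b₂, p₃.trans p₂,
      q₃.imp id fun ⟨hq, hex⟩ => ⟨hq, ?_⟩⟩
    unfold Exceeds at hex
    rw [l₂] at hex
    simp only [relabel, State.tick, Function.update_self] at hex
    rw [u₃]
    exact hex

/-! ### Soundness of the tentative costs and of the upper bounds -/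

/-- Every finite tentative cost is at least the cost of a suitable edge set. -/
def CostSound (N : STPInstance V) (l : Tuple V → ℕ∞) : Prop :=
  ∀ v I, l (v, I) ≠ ⊤ → ∃ F, N.EdgesOf F ∧ Joins F v I ∧ (N.edgeCost F : ℕ∞) ≤ l (v, I)

/-- Every finite upper bound `U J` is at least the cost of an edge set that connects every member
of `J` to a member of `S J ⊆ R \ J`. -/
def BoundSound (N : STPInstance V) (U : Finset V → ℕ∞) (S : Finset V → Finset V) : Prop :=
  ∀ J, U J ≠ ⊤ → S J ⊆ N.R \ J ∧ ∃ F, N.EdgesOf F ∧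
    (∀ x ∈ J, ∃ z ∈ S J, (SimpleGraph.fromEdgeSet (F : Set (Sym2 V))).Reachable x z) ∧
    (N.edgeCost F : ℕ∞) ≤ U J

theorem CostSound.treeCost_le [Fintype V] {l : Tuple V → ℕ∞} (h : CostSound N l) (v : V)
    (I : Finset V) : (N.treeCost v I : ℕ∞) ≤ l (v, I) := by
  by_cases ht : l (v, I) = ⊤
  · rw [ht]; exact le_top
  · obtain ⟨F, hF, hj, hc⟩ := h v I ht
    exact le_trans (by exact_mod_cast STPInstance.treeCost_le hF hj) hc

theorem CostSound.update {l : Tuple V → ℕ∞} (h : CostSound N l) {v : V} {I : Finset V} {c : ℕ∞}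
    (hc : ∃ F, N.EdgesOf F ∧ Joins F v I ∧ (N.edgeCost F : ℕ∞) ≤ c) :
    CostSound N (Function.update l (v, I) c) := by
  intro x J hx
  by_cases he : (x, J) = (v, I)
  · obtain ⟨rfl, rfl⟩ := Prod.ext_iff.1 he
    rw [Function.update_self]
    exact hc
  · rw [Function.update_of_ne he] at hx ⊢
    exact h x J hx

theorem CostSound.merge {l : Tuple V → ℕ∞} (h : CostSound N l) {w : V} {I J : Finset V}
    (ht : l (w, I) + l (w, J) ≠ ⊤) :
    ∃ F, N.EdgesOf F ∧ Joins F w (I ∪ J) ∧ (N.edgeCost F : ℕ∞) ≤ l (w, I) + l (w, J) := by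
  rw [Ne, ENat.add_eq_top, not_or] at ht
  obtain ⟨F, hF, hj, hc⟩ := h w I ht.1
  obtain ⟨F', hF', hj', hc'⟩ := h w J ht.2
  refine ⟨F ∪ F', hF.union hF', ?_, ?_⟩
  · intro x hx
    rcases Finset.mem_union.1 hx with hx | hx
    · exact hj.mono Finset.subset_union_left x hx
    · exact hj'.mono Finset.subset_union_right x hx
  · exact le_trans (by exact_mod_cast edgeCost_union_le F F') (add_le_add hc hc')

theorem CostSound.edge {l : Tuple V → ℕ∞} (h : CostSound N l) {w v : V} {I : Finset V}
    (hadj : N.graph.Adj w v) (ht : l (w, I) + N.cost s(w, v) ≠ ⊤) :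
    ∃ F, N.EdgesOf F ∧ Joins F v I ∧ (N.edgeCost F : ℕ∞) ≤ l (w, I) + N.cost s(w, v) := by
  rw [Ne, ENat.add_eq_top, not_or] at ht
  obtain ⟨F, hF, hj, hc⟩ := h w I ht.1
  refine ⟨F ∪ {s(w, v)}, hF.union ?_, ?_, ?_⟩
  · simpa [EdgesOf] using hadj
  · intro x hx
    refine SimpleGraph.Reachable.trans (v := w) (SimpleGraph.Adj.reachable ?_)
      (hj.mono Finset.subset_union_left x hx)
    rw [SimpleGraph.fromEdgeSet_adj]
    exact ⟨by simp [Sym2.eq_swap], hadj.ne.symm⟩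
  · refine le_trans (b := ((N.edgeCost F + N.cost s(w, v) : ℕ) : ℕ∞)) ?_ ?_
    · exact_mod_cast (edgeCost_union_le F {s(w, v)}).trans (by simp [edgeCost])
    · push_cast
      exact add_le_add hc le_rfl

theorem setDist_singleton (A : Finset V) (z : V) :
    N.setDist A {z} = ⊤ ∨ ∃ x ∈ A, N.setDist A {z} = N.dist x z := by
  have h : N.setDist A {z} = A.inf fun x => (N.dist x z : ℕ∞) := by
    simp [setDist, Finset.inf_eq_iInf]
  rcases A.eq_empty_or_nonempty with rfl | hA
  · left
    simp [h]
  · right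
    obtain ⟨x, hx, he⟩ := Finset.exists_mem_eq_inf A hA fun x => (N.dist x z : ℕ∞)
    exact ⟨x, hx, h.trans he⟩

/-- The edges behind `l (v, J)`, extended by a shortest path to `z` from `v` or from a member of
`J`, connect all of `J` to `z` through `v`. -/
theorem PruneUpdate.sound [Fintype V] {v : V} {J : Finset V} {s s' : State V}
    (h : PruneUpdate N v J s s') (hl : CostSound N s.l) (hU : BoundSound N s.U s.S) :
    BoundSound N s'.U s'.S := by
  rcases h with ⟨hlt, z, hz, hmin, rfl⟩ | ⟨-, rfl⟩
  swap
  · exact hU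
  intro K hK
  by_cases hKJ : K = J
  swap
  · simp only [Function.update_of_ne hKJ] at hK ⊢
    exact hU K hK
  subst hKJ
  simp only [Function.update_self]
  refine ⟨Finset.singleton_subset_iff.2 hz, ?_⟩
  have hb : bound N s v K ≠ ⊤ := hlt.ne_top
  unfold bound at hb ⊢
  rw [← hmin] at hb ⊢
  rw [Ne, ENat.add_eq_top, not_or] at hb
  obtain ⟨F, hF, hj, hc⟩ := hl v K hb.1
  obtain ⟨x, hx, hxd⟩ : ∃ x ∈ insert v K,
      min (N.setDist K {z}) (N.setDist {v} {z}) = (N.dist x z : ℕ∞) := by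
    rcases min_choice (N.setDist K {z}) (N.setDist {v} {z}) with hm | hm
    · rw [hm] at hb ⊢
      rcases setDist_singleton (N := N) K z with h | ⟨x, hx, h⟩
      · exact absurd h hb.2
      · exact ⟨x, by simp [hx], h⟩
    · rw [hm] at hb ⊢
      rcases setDist_singleton (N := N) {v} z with h | ⟨x, hx, h⟩
      · exact absurd h hb.2
      · exact ⟨x, by simp_all, h⟩
  rw [hxd]
  obtain ⟨F', hF', hr, hc'⟩ := exists_path (N := N) x z
  refine ⟨F ∪ F', hF.union hF', ?_, ?_⟩
  · intro y hy
    refine ⟨z, by simp, ?_⟩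
    have h₁ := hj.mono (Finset.subset_union_left (s₂ := F')) y hy
    have h₂ : (SimpleGraph.fromEdgeSet ((F ∪ F' : Finset _) : Set (Sym2 V))).Reachable v x := by
      rcases Finset.mem_insert.1 hx with rfl | hx
      · exact SimpleGraph.Reachable.refl _
      · exact hj.mono Finset.subset_union_left x hx
    exact (h₁.symm.trans h₂).trans (reachable_mono Finset.subset_union_right hr)
  · refine le_trans (b := ((N.edgeCost F + N.edgeCost F' : ℕ) : ℕ∞)) ?_ ?_
    · exact_mod_cast edgeCost_union_le F F'
    · push_cast
      rw [hc']
      exact add_le_add hc le_rfl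

theorem combine_sound {I J : Finset V} {s : State V} (hU : BoundSound N s.U s.S) :
    BoundSound N (combine N I J s).U (combine N I J s).S := by
  unfold combine
  split_ifs with h
  swap
  · exact hU
  obtain ⟨hI, hJ, hIJ⟩ := h
  intro K hK
  by_cases hKJ : K = I ∪ J
  swap
  · simp only [Function.update_of_ne hKJ] at hK ⊢
    exact hU K hK
  subst hKJ
  simp only [Function.update_self]
  obtain ⟨hSI, F, hF, hr, hc⟩ := hU I hI
  obtain ⟨hSJ, F', hF', hr', hc'⟩ := hU J hJ
  refine ⟨?_, F ∪ F', hF.union hF', ?_, ?_⟩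
  · intro x hx
    obtain ⟨hx, hx'⟩ := Finset.mem_sdiff.1 hx
    refine Finset.mem_sdiff.2 ⟨?_, hx'⟩
    rcases Finset.mem_union.1 hx with hx | hx
    · exact (Finset.mem_sdiff.1 (hSI hx)).1
    · exact (Finset.mem_sdiff.1 (hSJ hx)).1
  · have h₁ : ∀ x ∈ I, ∃ z ∈ s.S I,
        (SimpleGraph.fromEdgeSet ((F ∪ F' : Finset _) : Set (Sym2 V))).Reachable x z := by
      intro x hx
      obtain ⟨z, hz, h⟩ := hr x hx
      exact ⟨z, hz, reachable_mono Finset.subset_union_left h⟩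
    have h₂ : ∀ x ∈ J, ∃ z ∈ s.S J,
        (SimpleGraph.fromEdgeSet ((F ∪ F' : Finset _) : Set (Sym2 V))).Reachable x z := by
      intro x hx
      obtain ⟨z, hz, h⟩ := hr' x hx
      exact ⟨z, hz, reachable_mono Finset.subset_union_right h⟩
    generalize SimpleGraph.fromEdgeSet ((F ∪ F' : Finset _) : Set (Sym2 V)) = G at h₁ h₂ ⊢
    -- If `T₁` avoids `B`, it survives the removal of `A ∪ B`, so it serves all of `A`. A member of
    -- `B` reaches some `z ∈ T₂`, and if `z ∈ A` the connection continues from `z`.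
    have key : ∀ A B : Finset V, ∀ T₁ T₂ : Finset V, T₁ ⊆ N.R \ A → T₂ ⊆ N.R \ B →
        (∀ x ∈ A, ∃ z ∈ T₁, G.Reachable x z) → (∀ x ∈ B, ∃ z ∈ T₂, G.Reachable x z) →
        T₁ ∩ B = ∅ → ∀ x ∈ A ∪ B, ∃ z ∈ (T₁ ∪ T₂) \ (A ∪ B), G.Reachable x z := by
      intro A B T₁ T₂ hT₁ hT₂ hA hB hd x hx
      have hA' : ∀ x ∈ A, ∃ z ∈ (T₁ ∪ T₂) \ (A ∪ B), G.Reachable x z := by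
        intro x hx
        obtain ⟨z, hz, h⟩ := hA x hx
        refine ⟨z, ?_, h⟩
        have hzA := (Finset.mem_sdiff.1 (hT₁ hz)).2
        have hzB : z ∉ B := fun hzB => by
          have : z ∈ T₁ ∩ B := Finset.mem_inter.2 ⟨hz, hzB⟩
          simp [hd] at this
        simp [hz, hzA, hzB]
      rcases Finset.mem_union.1 hx with hx | hx
      · exact hA' x hx
      · obtain ⟨z, hz, h⟩ := hB x hx
        by_cases hzA : z ∈ A
        · obtain ⟨y, hy, h'⟩ := hA' z hzA
          exact ⟨y, hy, h.trans h'⟩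
        · have hzB := (Finset.mem_sdiff.1 (hT₂ hz)).2
          exact ⟨z, by simp [hz, hzA, hzB], h⟩
    rcases hIJ with hd | hd
    · exact key I J _ _ hSI hSJ h₁ h₂ hd
    · rw [Finset.union_comm I J, Finset.union_comm (s.S I)]
      exact key J I _ _ hSJ hSI h₂ h₁ hd
  · exact le_trans (by exact_mod_cast edgeCost_union_le F F') (add_le_add hc hc')

/-- Soundness of both kinds of bounds. -/
def Sound (N : STPInstance V) (s : State V) : Prop := CostSound N s.l ∧ BoundSound N s.U s.S

theorem Lowered.costSound {p : Tuple V} {c : ℕ∞} {B : Finset (Tuple V)} {s s' : State V}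
    (h : Lowered p c B s s') (hl : CostSound N s.l)
    (hc : ∃ F, N.EdgesOf F ∧ Joins F p.1 p.2 ∧ (N.edgeCost F : ℕ∞) ≤ c) : CostSound N s'.l := by
  rw [h.2.1]
  exact hl.update hc

theorem MergeBody.sound [Fintype V] {mode : Pruning} {w : V} {I J : Finset V} {s s' : State V}
    (h : MergeBody N mode w I J s s') (hs : Sound N s) : Sound N s' := by
  obtain ⟨hl, hU⟩ := hs
  refine ⟨?_, ?_⟩
  · rcases h.effect with ⟨h, -⟩ | ⟨-, -, h⟩
    · rw [h.1]; exact hl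
    · exact h.costSound hl (hl.merge h.1.ne_top)
  · cases h with
    | skip hJ => exact hU
    | keep hJ hl => exact hU
    | improve s₁ hJ hlt hs₁ hoff => subst hs₁; exact hU
    | improvePrune s₁ s₂ hJ hlt hs₁ hon hs₂ =>
      obtain ⟨-, -, -, u₃, s₃, -⟩ := pushUnless_frame (Exceeds s₂ w (I ∪ J)) (w, I ∪ J) s₂
      rw [u₃, s₃]
      refine hs₂.sound ?_ (combine_sound (by subst hs₁; exact hU))
      rw [(combine_frame I J s₁).1, hs₁]
      exact hl.update (hl.merge hlt.ne_top)

theorem EdgeBody.sound [Fintype V] {mode : Pruning} {w v : V} {I : Finset V} {s s' : State V}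
    (h : EdgeBody N mode w I v s s') (hadj : N.graph.Adj w v) (hs : Sound N s) : Sound N s' := by
  obtain ⟨hl, hU⟩ := hs
  refine ⟨?_, ?_⟩
  · rcases h.effect hadj.ne.symm with ⟨h, -⟩ | h
    · rw [h.1]; exact hl
    · exact h.costSound hl (hl.edge hadj h.1.ne_top)
  · cases h with
    | keep hl => exact hU
    | improve s₁ hlt hs₁ hoff => subst hs₁; exact hU
    | improvePruneExpanded s₁ s₂ hlt hs₁ hon hs₂ =>
      obtain ⟨-, -, -, u₃, s₃, -⟩ := pushUnless_frame (Exceeds s₂ w I) (v, I) s₂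
      rw [u₃, s₃]
      subst hs₁
      exact hs₂.sound (hl.update (hl.edge hadj hlt.ne_top)) hU
    | improvePruneReached s₁ s₂ hlt hs₁ hon hs₂ =>
      obtain ⟨-, -, -, u₃, s₃, -⟩ := pushUnless_frame (Exceeds s₂ v I) (v, I) s₂
      rw [u₃, s₃]
      subst hs₁
      exact hs₂.sound (hl.update (hl.edge hadj hlt.ne_top)) hU

theorem sound_init [Fintype V] (r : V) : Sound N (init N r) := by
  refine ⟨?_, ?_⟩
  · intro v I hI
    refine ⟨∅, by simp [EdgesOf], ?_, by simp [edgeCost]⟩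
    have : I = ∅ ∨ I = {v} := by
      by_contra hc
      rw [not_or] at hc
      simp [init, hc] at hI
    rcases this with rfl | rfl
    · simp [Joins]
    · intro x hx
      rw [Finset.mem_singleton.1 hx]
  · intro J hJ
    simp [init] at hJ

/-! ### Running times of the loop bodies -/

/-- As `1 ≤ |R|`, each term may be raised to a multiple of `|R| ^ 2`. The constants here and in the
next two bounds are sums of coefficients: `3 + 2 + 8 = 13`, `8 + 19 + 13 = 40` and `9 + 13 = 22`. -/
theorem pruneTime_le {J : Finset V} (hJ : J ⊆ N.R) :
    pruneTime N J ≤ 13 * N.R.card ^ 2 := by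
  have hk : 1 ≤ N.R.card := N.R_nonempty.card_pos
  have h₁ := Finset.card_le_card hJ
  have h₂ : (N.R \ J).card ≤ N.R.card := Finset.card_le_card Finset.sdiff_subset
  have h₃ := Nat.mul_le_mul h₁ h₂
  unfold pruneTime
  nlinarith

theorem MergeBody.time_le {mode : Pruning} {w : V} {I J : Finset V} {s s' : State V}
    (h : MergeBody N mode w I J s s') (hIJ : I ∪ J ⊆ N.R) :
    s'.time ≤ s.time + 40 * N.R.card ^ 2 := by
  have hk : 1 ≤ N.R.card := N.R_nonempty.card_pos
  have hp := pruneTime_le hIJ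
  have hk2 : N.R.card ≤ N.R.card ^ 2 := Nat.le_self_pow (by norm_num) _
  cases h with
  | skip hJ => simp only [State.tick]; omega
  | keep hJ hl => simp only [State.tick]; omega
  | improve s₁ hJ hl hs₁ hoff =>
    subst hs₁
    simp only [push, relabel, State.tick]
    omega
  | improvePrune s₁ s₂ hJ hl hs₁ hon hs₂ =>
    subst hs₁
    rw [(pushUnless_frame _ _ _).2.2.2.2.2.1, hs₂.frame.2.2.2.2,
      (combine_frame (N := N) _ _ _).2.2.2.2]
    simp only [relabel, State.tick]
    omega

theorem EdgeBody.time_le {mode : Pruning} {w v : V} {I : Finset V} {s s' : State V}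
    (h : EdgeBody N mode w I v s s') (hI : I ⊆ N.R) :
    s'.time ≤ s.time + 22 * N.R.card ^ 2 := by
  have hk : 1 ≤ N.R.card := N.R_nonempty.card_pos
  have hp := pruneTime_le hI
  have hk2 : N.R.card ≤ N.R.card ^ 2 := Nat.le_self_pow (by norm_num) _
  cases h with
  | keep hl => simp only [State.tick]; omega
  | improve s₁ hl hs₁ hoff =>
    subst hs₁
    simp only [push, relabel, State.tick]
    omega
  | improvePruneExpanded s₁ s₂ hl hs₁ hon hs₂ =>
    subst hs₁
    rw [(pushUnless_frame _ _ _).2.2.2.2.2.1, hs₂.frame.2.2.2.2]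
    simp only [relabel, State.tick]
    omega
  | improvePruneReached s₁ s₂ hl hs₁ hon hs₂ =>
    subst hs₁
    rw [(pushUnless_frame _ _ _).2.2.2.2.2.1, hs₂.frame.2.2.2.2]
    simp only [relabel, State.tick]
    omega

/-! ### Loops -/

theorem ForEach.preserves {α : Type u} {body : α → State V → State V → Prop} {L : List α}
    {s s' : State V} (h : ForEach body L s s') (Inv : State V → Prop)
    (hstep : ∀ a ∈ L, ∀ s s', Inv s → body a s s' → Inv s') (hs : Inv s) : Inv s' := by
  induction h with
  | nil => exact hs
  | cons hb _ ih =>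
    exact ih (fun a ha => hstep a (List.mem_cons_of_mem _ ha))
      (hstep _ List.mem_cons_self _ _ hs hb)

theorem ForEach.time_le {α : Type u} {body : α → State V → State V → Prop} {L : List α}
    {s s' : State V} (h : ForEach body L s s') {B : ℕ}
    (hstep : ∀ a ∈ L, ∀ s s', body a s s' → s'.time ≤ s.time + B) :
    s'.time ≤ s.time + L.length * B := by
  induction h with
  | nil => simp
  | cons hb _ ih =>
    have h₁ := ih (fun a ha => hstep a (List.mem_cons_of_mem _ ha))
    have h₂ := hstep _ List.mem_cons_self _ _ hb
    rw [List.length_cons, Nat.succ_mul]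
    omega

/-- Meant for the relaxation inequalities: each round establishes its own, and later rounds, which
only lower labels, preserve it. -/
theorem ForEach.post {α : Type u} {body : α → State V → State V → Prop} {L : List α}
    {s s' : State V} (h : ForEach body L s s') (Inv : State V → Prop)
    (hstep : ∀ a ∈ L, ∀ s s', Inv s → body a s s' → Inv s') (hs : Inv s)
    (Post : α → State V → Prop)
    (hpost : ∀ a ∈ L, ∀ s s', Inv s → body a s s' → Post a s')
    (hkeep : ∀ a ∈ L, ∀ s s', Inv s → body a s s' → ∀ b, Post b s → Post b s') :
    ∀ a ∈ L, Post a s' := by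
  induction h with
  | nil => simp
  | @cons a L s s₁ s₂ hb hL ih =>
    have hs₁ := hstep _ List.mem_cons_self _ _ hs hb
    have hmem : ∀ a' ∈ L, a' ∈ a :: L := fun a' => List.mem_cons_of_mem _
    intro a' ha'
    rcases List.mem_cons.1 ha' with rfl | ha'
    · exact (hL.preserves (fun s => Inv s ∧ Post a' s)
        (fun b hb s s' hi h => ⟨hstep b (hmem b hb) s s' hi.1 h,
          hkeep b (hmem b hb) s s' hi.1 h a' hi.2⟩)
        ⟨hs₁, hpost _ List.mem_cons_self _ _ hs hb⟩).2
    · exact ih (fun b hb => hstep b (hmem b hb)) hs₁ (fun b hb => hpost b (hmem b hb))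
        (fun b hb => hkeep b (hmem b hb)) a' ha'

/-! ### The invariant of the main loop -/

/-- The tuple `(v, I)` occurs in the decomposition of some Steiner minimal tree for `R`. -/
def Good (N : STPInstance V) (r v : V) (I : Finset V) : Prop :=
  I ⊆ N.nonroot r ∧ I.Nonempty ∧
    N.treeCost v I + N.treeCost v (N.R \ I) ≤ N.treeCost r (N.nonroot r)

theorem mem_nonroot {r x : V} : x ∈ N.nonroot r ↔ x ≠ r ∧ x ∈ N.R := Finset.mem_erase

theorem nonroot_subset (r : V) : N.nonroot r ⊆ N.R := Finset.erase_subset _ _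

/-- An upper bound for `I` is never below the tentative cost of an optimal good tuple. -/
theorem BoundSound.le [Fintype V] {r v : V} {I : Finset V} {U : Finset V → ℕ∞}
    {S : Finset V → Finset V} (hr : r ∈ N.R) (h : BoundSound N U S) (hg : Good N r v I) :
    (N.treeCost v I : ℕ∞) ≤ U I := by
  by_cases ht : U I = ⊤
  · rw [ht]; exact le_top
  obtain ⟨hS, F, hF, hreach, hc⟩ := h I ht
  obtain ⟨F', hF', hj', hc'⟩ := exists_joins (N := N) v (N.R \ I)
  have hrI : r ∉ I := fun hrI => (mem_nonroot.1 (hg.1 hrI)).1 rfl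
  -- The exchange: the end points in `S I` lie in `R \ I`, so `F'` links them to `v`.
  have hj : ∀ x ∈ N.R,
      (SimpleGraph.fromEdgeSet ((F ∪ F' : Finset _) : Set (Sym2 V))).Reachable v x := by
    intro x hx
    by_cases hxI : x ∈ I
    · obtain ⟨z, hz, hxz⟩ := hreach x hxI
      exact (reachable_mono Finset.subset_union_right (hj' z (hS hz))).trans
        (reachable_mono Finset.subset_union_left hxz.symm)
    · exact reachable_mono Finset.subset_union_right (hj' x (by simp [hx, hxI]))
  have hle : N.treeCost r (N.nonroot r) ≤ N.edgeCost F + N.edgeCost F' :=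
    (STPInstance.treeCost_le (hF.union hF')
      (fun x hx => (hj r hr).symm.trans (hj x (nonroot_subset r hx)))).trans
      (edgeCost_union_le F F')
  refine le_trans ?_ hc
  have := hg.2.2
  exact_mod_cast (by omega : N.treeCost v I ≤ N.edgeCost F)

/-- `(v, I)` is good and its tentative cost is optimal. -/
def Optimal (N : STPInstance V) (r : V) (s : State V) (v : V) (I : Finset V) : Prop :=
  Good N r v I ∧ s.l (v, I) = N.treeCost v I

/-- The form of the retracing set `B` of `p`: it is given by an edge or by a partition. -/
def BackForm (l : Tuple V → ℕ∞) (p : Tuple V) (c : ℕ∞) (B : Finset (Tuple V)) : Prop :=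
  (∃ w, w ≠ p.1 ∧ B = {(w, p.2)} ∧ l (w, p.2) < c) ∨
    ∃ I J : Finset V, I.Nonempty ∧ J.Nonempty ∧ Disjoint I J ∧ I ∪ J = p.2 ∧
      B = {(p.1, I), (p.1, J)}

/-- The invariant of the main loop; the tuples in `X` need not have been propagated. -/
structure Inv (N : STPInstance V) (r : V) (X : Set (Tuple V)) (s : State V) : Prop where
  sound : Sound N s
  queue : ∀ p ∈ s.Q, p.2 ⊆ N.nonroot r ∧ p.2.Nonempty
  back : ∀ p, s.b p = ∅ ∨ BackForm s.l p (s.l p) (s.b p)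
  queued : ∀ v I, Optimal N r s v I → (v, I) ∈ s.P ∨ (v, I) ∈ s.Q
  edges : ∀ v I, Optimal N r s v I → (v, I) ∈ s.P → (v, I) ∉ s.Q → (v, I) ∉ X →
    ∀ x, N.graph.Adj v x → s.l (x, I) ≤ s.l (v, I) + N.cost s(v, x)
  merges : ∀ v I J, Optimal N r s v I → (v, I) ∈ s.P → (v, I) ∉ s.Q → (v, I) ∉ X →
    Optimal N r s v J → (v, J) ∈ s.P → (v, J) ∉ s.Q → (v, J) ∉ X → Disjoint I J →
    s.l (v, I ∪ J) ≤ s.l (v, I) + s.l (v, J)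

theorem Same.inv {r : V} {X : Set (Tuple V)} {s s' : State V} (h : Same s s')
    (hs : Inv N r X s) : Inv N r X s' := by
  obtain ⟨l, b, Q, P, U, S, t⟩ := s
  obtain ⟨l', b', Q', P', U', S', t'⟩ := s'
  obtain ⟨rfl, rfl, rfl, rfl, rfl, rfl⟩ := h
  exact ⟨hs.sound, hs.queue, hs.back, hs.queued, hs.edges, hs.merges⟩

theorem Lowered.le {p : Tuple V} {c : ℕ∞} {B : Finset (Tuple V)} {s s' : State V}
    (h : Lowered p c B s s') (q : Tuple V) : s'.l q ≤ s.l q := by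
  rw [h.2.1]
  by_cases hq : q = p
  · subst hq
    rw [Function.update_self]
    exact h.1.le
  · rw [Function.update_of_ne hq]

theorem BackForm.mono {l l' : Tuple V → ℕ∞} {p : Tuple V} {c : ℕ∞} {B : Finset (Tuple V)}
    (hl : ∀ q, l' q ≤ l q) (h : BackForm l p c B) : BackForm l' p c B := by
  rcases h with ⟨w, hw, hB, hlt⟩ | h
  · exact Or.inl ⟨w, hw, hB, (hl _).trans_lt hlt⟩
  · exact Or.inr h

/-- If `p` becomes optimal, `BoundSound.le` rules out that it was pruned. It is then queued, and
`edges` and `merges` claim nothing about it as a source. Other tuples keep their labels, so their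
inequalities can only gain. -/
theorem Lowered.inv [Fintype V] {r : V} (hr : r ∈ N.R) {X : Set (Tuple V)} {p : Tuple V}
    {c : ℕ∞} {B : Finset (Tuple V)} {s s' : State V} (h : Lowered p c B s s')
    (hs' : Sound N s') (hp : p.2 ⊆ N.nonroot r ∧ p.2.Nonempty) (hB : BackForm s.l p c B)
    (hs : Inv N r X s) : Inv N r X s' := by
  have hle := h.le
  obtain ⟨hlt, hl, hb, hP, hQ⟩ := h
  have hlp : s'.l p = c := by rw [hl, Function.update_self]
  have hlq : ∀ q, q ≠ p → s'.l q = s.l q := fun q hq => by rw [hl, Function.update_of_ne hq]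
  have hQmem : ∀ q, q ∈ s.Q → q ∈ s'.Q := by
    intro q hq
    rcases hQ with hQ | ⟨hQ, -⟩ <;> rw [hQ]
    · exact Finset.mem_insert_of_mem hq
    · exact hq
  have hQmem' : ∀ q, q ∈ s'.Q → q = p ∨ q ∈ s.Q := by
    intro q hq
    rcases hQ with hQ | ⟨hQ, -⟩ <;> rw [hQ] at hq
    · exact Finset.mem_insert.1 hq
    · exact Or.inr hq
  have hopt : ∀ v I, (v, I) = p → Optimal N r s' v I → (v, I) ∈ s'.Q := by
    intro v I hvI ho
    rcases hQ with hQ | ⟨-, hU⟩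
    · rw [hQ, hvI]; exact Finset.mem_insert_self _ _
    · exfalso
      have h₁ := hs'.2.le hr ho.1
      have h₂ := ho.2
      rw [hvI, hlp] at h₂
      rw [← h₂] at h₁
      rw [← hvI] at hU
      exact absurd h₁ (not_le.2 hU)
  have hopt' : ∀ v I, (v, I) ≠ p → Optimal N r s' v I → Optimal N r s v I := by
    intro v I hvI ho
    exact ⟨ho.1, by rw [← hlq _ hvI]; exact ho.2⟩
  have hnot : ∀ v I, Optimal N r s' v I → (v, I) ∉ s'.Q → (v, I) ≠ p :=
    fun v I ho hq he => hq (hopt v I he ho)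
  refine ⟨hs', ?_, ?_, ?_, ?_, ?_⟩
  · intro q hq
    rcases hQmem' q hq with rfl | hq
    · exact hp
    · exact hs.queue q hq
  · intro q
    by_cases hq : q = p
    · subst hq
      right
      rw [hlp, hb, Function.update_self]
      exact hB.mono hle
    · rw [hb, Function.update_of_ne hq, hlq q hq]
      exact (hs.back q).imp id fun h => h.mono hle
  · intro v I ho
    by_cases hq : (v, I) = p
    · exact Or.inr (hopt v I hq ho)
    · rw [hP]
      exact (hs.queued v I (hopt' v I hq ho)).imp id (hQmem _)
  · intro v I ho hvP hvQ hvX x hx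
    have hq := hnot v I ho hvQ
    rw [hlq _ hq]
    exact (hle _).trans (hs.edges v I (hopt' v I hq ho) (hP ▸ hvP)
      (fun h => hvQ (hQmem _ h)) hvX x hx)
  · intro v I J ho hvP hvQ hvX ho' hvP' hvQ' hvX' hd
    have hq := hnot v I ho hvQ
    have hq' := hnot v J ho' hvQ'
    rw [hlq _ hq, hlq _ hq']
    exact (hle _).trans (hs.merges v I J (hopt' v I hq ho) (hP ▸ hvP)
      (fun h => hvQ (hQmem _ h)) hvX (hopt' v J hq' ho') (hP ▸ hvP')
      (fun h => hvQ' (hQmem _ h)) hvX' hd)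

/-- What the expansion of `(w, I)` leaves unchanged. -/
structure Frame (w : V) (I : Finset V) (s₀ s : State V) : Prop where
  self : s.l (w, I) = s₀.l (w, I)
  self_notMem : (w, I) ∉ s.Q
  other : ∀ q : Tuple V, q.2 ≠ I → ¬ I ⊂ q.2 → s.l q = s₀.l q ∧ (q ∈ s.Q ↔ q ∈ s₀.Q)
  layer : ∀ v, (s.l (v, I) = s₀.l (v, I) ∧ ((v, I) ∈ s.Q → (v, I) ∈ s₀.Q)) ∨
    s₀.l (w, I) < s.l (v, I)
  le : ∀ q, s.l q ≤ s₀.l q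
  expanded : s.P = insert (w, I) s₀.P

theorem Same.frame {w : V} {I : Finset V} {s₀ s s' : State V} (h : Same s s')
    (hs : Frame w I s₀ s) : Frame w I s₀ s' := by
  obtain ⟨l, b, Q, P, U, S, t⟩ := s
  obtain ⟨l', b', Q', P', U', S', t'⟩ := s'
  obtain ⟨rfl, rfl, rfl, rfl, rfl, rfl⟩ := h
  exact ⟨hs.self, hs.self_notMem, hs.other, hs.layer, hs.le, hs.expanded⟩

theorem Lowered.frame {w : V} {I : Finset V} {p : Tuple V} {c : ℕ∞} {B : Finset (Tuple V)}
    {s₀ s s' : State V} (h : Lowered p c B s s')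
    (hp : I ⊂ p.2 ∨ (p.2 = I ∧ p.1 ≠ w ∧ s₀.l (w, I) < c)) (hs : Frame w I s₀ s) :
    Frame w I s₀ s' := by
  have hle := h.le
  obtain ⟨hlt, hl, hb, hP, hQ⟩ := h
  have hlp : s'.l p = c := by rw [hl, Function.update_self]
  have hlq : ∀ q, q ≠ p → s'.l q = s.l q := fun q hq => by rw [hl, Function.update_of_ne hq]
  have hQq : ∀ q, q ≠ p → (q ∈ s'.Q ↔ q ∈ s.Q) := by
    intro q hq
    rcases hQ with hQ | ⟨hQ, -⟩ <;> rw [hQ]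
    rw [Finset.mem_insert, or_iff_right hq]
  have hw : (w, I) ≠ p := by
    rintro rfl
    rcases hp with h | ⟨-, h, -⟩
    · exact (ssubset_irrefl _ h).elim
    · exact h rfl
  refine ⟨(hlq _ hw).trans hs.self, fun h => hs.self_notMem ((hQq _ hw).1 h), ?_, ?_,
    fun q => (hle q).trans (hs.le q), hP.trans hs.expanded⟩
  · intro q hq₁ hq₂
    have hq : q ≠ p := by
      rintro rfl
      exact hp.elim hq₂ fun h => hq₁ h.1
    rw [hlq q hq, hQq q hq]
    exact hs.other q hq₁ hq₂
  · intro v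
    by_cases hv : (v, I) = p
    · right
      rw [hv, hlp]
      rcases hp with h | ⟨-, -, h⟩
      · rw [← hv] at h
        exact (ssubset_irrefl _ h).elim
      · exact h
    · rw [hlq _ hv, hQq _ hv]
      exact hs.layer v

theorem select_frame (w : V) (I : Finset V) (s : State V) :
    Frame w I s (select N (w, I) s) := by
  refine ⟨rfl, by simp [select], ?_, ?_, fun _ => le_rfl, rfl⟩
  · intro q hq _
    refine ⟨rfl, ?_⟩
    have : q ≠ (w, I) := by rintro rfl; exact hq rfl
    simp [select, this]
  · intro v
    exact Or.inl ⟨rfl, fun h => Finset.mem_of_mem_erase h⟩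

theorem select_inv {r w : V} {I : Finset V} {s : State V} (hs : Inv N r ∅ s) :
    Inv N r {(w, I)} (select N (w, I) s) := by
  have hP : ∀ v J, (v, J) ∉ ({(w, I)} : Set (Tuple V)) → (v, J) ∈ insert (w, I) s.P →
      (v, J) ∈ s.P := fun v J h h' => (Finset.mem_insert.1 h').resolve_left h
  have hQ : ∀ v J, (v, J) ∉ ({(w, I)} : Set (Tuple V)) → (v, J) ∉ s.Q.erase (w, I) →
      (v, J) ∉ s.Q := fun v J h h' h'' => h' (Finset.mem_erase.2 ⟨h, h''⟩)
  refine ⟨hs.sound, fun p hp => hs.queue p (Finset.mem_of_mem_erase hp), hs.back, ?_, ?_, ?_⟩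
  · intro v J ho
    by_cases hv : (v, J) = (w, I)
    · left
      rw [hv]
      exact Finset.mem_insert_self _ _
    · exact (hs.queued v J ho).imp Finset.mem_insert_of_mem
        fun h => Finset.mem_erase.2 ⟨hv, h⟩
  · intro v J ho h₁ h₂ h₃
    exact hs.edges v J ho (hP v J h₃ h₁) (hQ v J h₃ h₂) (Set.notMem_empty _)
  · intro v J K ho h₁ h₂ h₃ ho' h₁' h₂' h₃'
    exact hs.merges v J K ho (hP v J h₃ h₁) (hQ v J h₃ h₂) (Set.notMem_empty _)
      ho' (hP v K h₃' h₁') (hQ v K h₃' h₂') (Set.notMem_empty _)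

theorem ssubset_union_of_disjoint {I J : Finset V} (h : Disjoint I J) (hJ : J.Nonempty) :
    I ⊂ I ∪ J := by
  refine Finset.ssubset_iff_subset_ne.2 ⟨Finset.subset_union_left, fun he => ?_⟩
  obtain ⟨x, hx⟩ := hJ
  exact Finset.disjoint_left.1 h (he ▸ Finset.mem_union_right _ hx) hx

/-- The state inside the inner loops of the expansion of `(w, I)`. -/
def Mid (N : STPInstance V) (r w : V) (I : Finset V) (s₀ s : State V) : Prop :=
  Inv N r {(w, I)} s ∧ Frame w I s₀ s

theorem MergeBody.mid [Fintype V] {mode : Pruning} {r w : V} (hr : r ∈ N.R) {I J : Finset V}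
    {s₀ s s' : State V} (hI : I ⊆ N.nonroot r) (hI' : I.Nonempty) (hJ : J ⊆ N.nonroot r \ I)
    (hs : Mid N r w I s₀ s) (h : MergeBody N mode w I J s s') : Mid N r w I s₀ s' := by
  have hd : Disjoint I J := Finset.disjoint_of_subset_right hJ Finset.disjoint_sdiff
  rcases h.effect with ⟨hsame, -⟩ | ⟨hJne, -, hlow⟩
  · exact ⟨hsame.inv hs.1, hsame.frame hs.2⟩
  · have hJ' := Finset.nonempty_iff_ne_empty.2 hJne
    refine ⟨hlow.inv hr (h.sound hs.1.sound) ⟨?_, hI'.mono Finset.subset_union_left⟩ ?_ hs.1,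
      hlow.frame (Or.inl (ssubset_union_of_disjoint hd hJ')) hs.2⟩
    · exact Finset.union_subset hI (hJ.trans Finset.sdiff_subset)
    · exact Or.inr ⟨I, J, hI', hJ', hd, rfl, rfl⟩

theorem EdgeBody.mid [Fintype V] {mode : Pruning} {r w v : V} (hr : r ∈ N.R) {I : Finset V}
    {s₀ s s' : State V} (hI : I ⊆ N.nonroot r) (hI' : I.Nonempty) (hadj : N.graph.Adj w v)
    (hs : Mid N r w I s₀ s) (h : EdgeBody N mode w I v s s') : Mid N r w I s₀ s' := by
  rcases h.effect hadj.ne.symm with ⟨hsame, -⟩ | hlow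
  · exact ⟨hsame.inv hs.1, hsame.frame hs.2⟩
  -- Strictness needs a positive edge cost and a finite label; the label is finite because the sum
  -- lies below another label. Both `BackForm` and `Frame.layer` rest on this inequality.
  · have hlt : s.l (w, I) < s.l (w, I) + N.cost s(w, v) := by
      have ht : s.l (w, I) ≠ ⊤ := fun ht => by
        have := hlow.1
        rw [ht, top_add] at this
        exact not_top_lt this
      have hpos : 0 < N.cost s(w, v) := N.cost_pos _ hadj
      lift s.l (w, I) to ℕ using ht with m
      exact_mod_cast Nat.lt_add_of_pos_right hpos
    refine ⟨hlow.inv hr (h.sound hadj hs.1.sound) ⟨hI, hI'⟩ ?_ hs.1,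
      hlow.frame (Or.inr ⟨rfl, hadj.ne.symm, ?_⟩) hs.2⟩
    · exact Or.inl ⟨w, hadj.ne, rfl, hlt⟩
    · rw [← hs.2.self]
      exact hlt

theorem MergeBody.le {mode : Pruning} {w : V} {I J : Finset V} {s s' : State V}
    (h : MergeBody N mode w I J s s') (q : Tuple V) : s'.l q ≤ s.l q := by
  rcases h.effect with ⟨hsame, -⟩ | ⟨-, -, hlow⟩
  · rw [hsame.1]
  · exact hlow.le q

theorem EdgeBody.le {mode : Pruning} {w v : V} {I : Finset V} {s s' : State V} (hvw : v ≠ w)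
    (h : EdgeBody N mode w I v s s') (q : Tuple V) : s'.l q ≤ s.l q := by
  rcases h.effect hvw with ⟨hsame, -⟩ | hlow
  · rw [hsame.1]
  · exact hlow.le q

/-- The loops change neither the label of `(w, I)` nor that of `(w, J)` for `J` disjoint from `I`.
So the inequalities they enforce persist to the end, and the exemption of `(w, I)` from propagation
is lifted. -/
theorem expansion_inv [Fintype V] {mode : Pruning} {r w : V} (hr : r ∈ N.R) {I : Finset V}
    {s s₁ s' : State V} (hs : Inv N r ∅ s) (hw : (w, I) ∈ s.Q) {Js : List (Finset V)}
    {vs : List V} (hJs : ∀ J, J ∈ Js ↔ J ⊆ N.nonroot r \ I) (hvs : ∀ v, v ∈ vs ↔ N.graph.Adj w v)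
    (h₁ : ForEach (MergeBody N mode w I) Js (select N (w, I) s) s₁)
    (h₂ : ForEach (EdgeBody N mode w I) vs s₁ s') : Inv N r ∅ s' ∧ Frame w I s s' := by
  obtain ⟨hI, hI'⟩ := hs.queue _ hw
  have hmid₀ : Mid N r w I s (select N (w, I) s) := ⟨select_inv hs, select_frame w I s⟩
  have hstep₁ : ∀ J ∈ Js, ∀ t t', Mid N r w I s t → MergeBody N mode w I J t t' →
      Mid N r w I s t' := fun J hJ t t' ht h => h.mid hr hI hI' ((hJs J).1 hJ) ht
  have hstep₂ : ∀ v ∈ vs, ∀ t t', Mid N r w I s t → EdgeBody N mode w I v t t' →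
      Mid N r w I s t' := fun v hv t t' ht h => h.mid hr hI hI' ((hvs v).1 hv) ht
  have hmid₁ := h₁.preserves _ hstep₁ hmid₀
  have hmid₂ := h₂.preserves _ hstep₂ hmid₁
  have hdisj : ∀ J ∈ Js, Disjoint I J := fun J hJ =>
    Finset.disjoint_of_subset_right ((hJs J).1 hJ) Finset.disjoint_sdiff
  have hother : ∀ J, Disjoint I J → ∀ t, Frame w I s t → t.l (w, J) = s.l (w, J) := by
    intro J hJ t ht
    obtain ⟨x, hx⟩ := hI'
    refine (ht.other (w, J) ?_ ?_).1
    · rintro (rfl : J = I)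
      exact Finset.disjoint_left.1 hJ hx hx
    · intro hIJ
      exact Finset.disjoint_left.1 hJ hx (hIJ.subset hx)
  have hmerge := h₁.post _ hstep₁ hmid₀
    (fun J t => J = ∅ ∨ (w, J) ∉ insert (w, I) s.P ∨ t.l (w, I ∪ J) ≤ s.l (w, I) + s.l (w, J))
    (by
      intro J hJ t t' ht h
      have hlI := ht.2.self
      have hlJ := hother J (hdisj J hJ) t ht.2
      rw [← hlI, ← hlJ, ← ht.2.expanded]
      rcases h.effect with ⟨hsame, h⟩ | ⟨-, -, hlow⟩
      · rwa [hsame.1]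
      · right; right
        rw [hlow.2.1, Function.update_self])
    (fun J hJ t t' ht h K hK => hK.imp id fun hK => hK.imp id fun hK => (h.le _).trans hK)
  have hedge := h₂.post _ hstep₂ hmid₁
    (fun v t => t.l (v, I) ≤ s.l (w, I) + N.cost s(w, v))
    (by
      intro v hv t t' ht h
      rw [← ht.2.self]
      rcases h.effect ((hvs v).1 hv).ne.symm with ⟨hsame, h⟩ | hlow
      · rwa [hsame.1]
      · rw [hlow.2.1, Function.update_self])
    (fun v hv t t' ht h K hK => (h.le ((hvs v).1 hv).ne.symm _).trans hK)
  have hle : ∀ q, s'.l q ≤ s₁.l q := h₂.preserves (fun t => ∀ q, t.l q ≤ s₁.l q)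
    (fun v hv t t' ht h q => (h.le ((hvs v).1 hv).ne.symm q).trans (ht q)) (fun _ => le_rfl)
  have hmerge' : ∀ J, J ⊆ N.nonroot r → J.Nonempty → Disjoint I J → (w, J) ∈ s'.P →
      s'.l (w, I ∪ J) ≤ s'.l (w, I) + s'.l (w, J) := by
    intro J hJ hJne hd hJP
    rw [hmid₂.2.expanded] at hJP
    rw [hmid₂.2.self, hother J hd s' hmid₂.2]
    have := hmerge J ((hJs J).2 (Finset.subset_sdiff.2 ⟨hJ, hd.symm⟩))
    rcases this with h | h | h
    · exact absurd h hJne.ne_empty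
    · exact absurd hJP h
    · exact (hle _).trans h
  refine ⟨⟨hmid₂.1.sound, hmid₂.1.queue, hmid₂.1.back, hmid₂.1.queued, ?_, ?_⟩, hmid₂.2⟩
  · intro v J ho hP hQ _ x hx
    by_cases hv : (v, J) = (w, I)
    · obtain ⟨rfl, rfl⟩ := Prod.ext_iff.1 hv
      rw [hmid₂.2.self]
      exact hedge x ((hvs x).2 hx)
    · exact hmid₂.1.edges v J ho hP hQ hv x hx
  · intro v J K ho hP hQ _ ho' hP' hQ' _ hd
    by_cases hv : (v, J) = (w, I)
    · obtain ⟨rfl, rfl⟩ := Prod.ext_iff.1 hv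
      exact hmerge' K ho'.1.1 ho'.1.2.1 hd hP'
    by_cases hv' : (v, K) = (w, I)
    · obtain ⟨rfl, rfl⟩ := Prod.ext_iff.1 hv'
      rw [Finset.union_comm, add_comm]
      exact hmerge' J ho.1.1 ho.1.2.1 hd.symm hP
    exact hmid₂.1.merges v J K ho hP hQ hv ho' hP' hQ' hv' hd

theorem init_inv [Fintype V] {r : V} : Inv N r ∅ (init N r) := by
  refine ⟨sound_init r, ?_, fun _ => Or.inl rfl, ?_, ?_, ?_⟩
  · intro p hp
    simp only [init, Finset.mem_image] at hp
    obtain ⟨t, ht, rfl⟩ := hp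
    exact ⟨Finset.singleton_subset_iff.2 ht, Finset.singleton_nonempty t⟩
  · intro v I ho
    right
    obtain ⟨⟨hI, hne, -⟩, hl⟩ := ho
    have : I = ∅ ∨ (v ∈ N.nonroot r ∧ I = {v}) := by
      by_contra hc
      simp only [init] at hl
      rw [if_neg hc] at hl
      exact ENat.natCast_ne_top _ hl.symm
    rcases this with h | ⟨hv, rfl⟩
    · exact absurd h hne.ne_empty
    · simp only [init, Finset.mem_image]
      exact ⟨v, hv, rfl⟩
  · intro v I _ hP
    simp [init] at hP
  · intro v I J _ hP
    simp [init] at hP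

/-! ### The queue does not run empty -/

/-- The edge passes from the part for `I` to the part for `R \ I`, so the total does not grow. -/
theorem Good.edge [Fintype V] {r v w : V} {I : Finset V} (h : Good N r v I)
    (hadj : N.graph.Adj w v)
    (hle : N.treeCost w I + N.cost s(w, v) ≤ N.treeCost v I) : Good N r w I := by
  refine ⟨h.1, h.2.1, ?_⟩
  obtain ⟨F, hF, hj, hc⟩ := exists_joins (N := N) v (N.R \ I)
  have hE : N.EdgesOf (F ∪ {s(w, v)}) := hF.union (by simpa [EdgesOf] using hadj)
  have := STPInstance.treeCost_le (v := w) (I := N.R \ I) hE (by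
    intro x hx
    refine SimpleGraph.Reachable.trans (v := v) (SimpleGraph.Adj.reachable ?_)
      (hj.mono Finset.subset_union_left x hx)
    rw [SimpleGraph.fromEdgeSet_adj]
    exact ⟨by simp, hadj.ne⟩)
  have h' : N.edgeCost (F ∪ {s(w, v)}) ≤ N.edgeCost F + N.cost s(w, v) :=
    (edgeCost_union_le F {s(w, v)}).trans (by simp [edgeCost])
  have := h.2.2
  omega

/-- The part for `J` joins the complementary part at `v`. -/
theorem Good.left [Fintype V] {r v : V} {I J : Finset V} (h : Good N r v (I ∪ J))
    (hI : I.Nonempty) (hle : N.treeCost v I + N.treeCost v J ≤ N.treeCost v (I ∪ J)) :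
    Good N r v I := by
  refine ⟨Finset.subset_union_left.trans h.1, hI, ?_⟩
  obtain ⟨F, hF, hj, hc⟩ := exists_joins (N := N) v (N.R \ (I ∪ J))
  obtain ⟨F', hF', hj', hc'⟩ := exists_joins (N := N) v J
  have := STPInstance.treeCost_le (v := v) (I := N.R \ I) (hF.union hF') (by
    intro x hx
    obtain ⟨hx, hxI⟩ := Finset.mem_sdiff.1 hx
    by_cases hxJ : x ∈ J
    · exact hj'.mono Finset.subset_union_right x hxJ
    · exact hj.mono Finset.subset_union_left x (by simp [hx, hxI, hxJ]))
  have h' := edgeCost_union_le (N := N) F F'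
  have := h.2.2
  omega

theorem good_root [Fintype V] {r : V} (hr : r ∈ N.R) (hR : (N.nonroot r).Nonempty) :
    Good N r r (N.nonroot r) := by
  refine ⟨subset_rfl, hR, ?_⟩
  have : N.R \ N.nonroot r = {r} := by
    ext x
    simp only [Finset.mem_sdiff, mem_nonroot, Finset.mem_singleton]
    constructor
    · rintro ⟨h₁, h₂⟩
      by_contra hx
      exact h₂ ⟨hx, h₁⟩
    · rintro rfl
      exact ⟨hr, fun h => h.1 rfl⟩
  rw [this, treeCost_singleton, add_zero]

/-- Double induction: a Dreyfus–Wagner edge keeps `I` and lowers the tree cost, a partition lowers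
`|I|`. With an empty queue, `edges` and `merges` apply to every optimal tuple. -/
theorem Inv.optimal_of_queue_empty [Fintype V] {r : V} {s : State V} (hs : Inv N r ∅ s)
    (hinit : ∀ v, s.l (v, {v}) = 0 ∨ v ∉ N.nonroot r) (hQ : s.Q = ∅) :
    ∀ (m k : ℕ) (v : V) (I : Finset V), I.card = m → N.treeCost v I = k → Good N r v I →
      Optimal N r s v I := by
  intro m
  induction m using Nat.strong_induction_on with
  | _ m ihm =>
  intro k
  induction k using Nat.strong_induction_on with
  | _ k ihk =>
  intro v I hm hk hg
  refine ⟨hg, le_antisymm ?_ (hs.sound.1.treeCost_le v I)⟩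
  have hP : ∀ v I, Optimal N r s v I → (v, I) ∈ s.P := fun v I ho =>
    (hs.queued v I ho).resolve_right (by simp [hQ])
  by_cases hv : I = {v}
  · subst hv
    rw [(hinit v).resolve_right (fun h => h (hg.1 (by simp)))]
    exact zero_le
  rcases dreyfusWagner (N := N) v hg.2.1 hv with ⟨w, hadj, hle⟩ | ⟨I₁, I₂, hn₁, hn₂, hd, rfl, hle⟩
  · have hpos : 0 < N.cost s(w, v) := N.cost_pos _ hadj
    have ho := ihk (N.treeCost w I) (by omega) w I hm rfl (hg.edge hadj hle)
    refine (hs.edges w I ho (hP w I ho) (by simp [hQ]) (Set.notMem_empty _) v hadj).trans ?_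
    rw [ho.2]
    exact_mod_cast hle
  · rw [Finset.card_union_of_disjoint hd] at hm
    have hc₁ := hn₁.card_pos
    have hc₂ := hn₂.card_pos
    have ho₁ := ihm I₁.card (by omega) _ v I₁ rfl rfl (hg.left hn₁ hle)
    have ho₂ := ihm I₂.card (by omega) _ v I₂ rfl rfl
      (Good.left (J := I₁) (by rwa [Finset.union_comm]) hn₂
        (by rw [Finset.union_comm, add_comm]; exact hle))
    refine (hs.merges v I₁ I₂ ho₁ (hP _ _ ho₁) (by simp [hQ]) (Set.notMem_empty _)
      ho₂ (hP _ _ ho₂) (by simp [hQ]) (Set.notMem_empty _) hd).trans ?_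
    rw [ho₁.2, ho₂.2]
    exact_mod_cast hle

theorem Inv.reached [Fintype V] {r : V} (hr : r ∈ N.R) {s : State V} (hs : Inv N r ∅ s)
    (hinit : ∀ v, s.l (v, {v}) = 0 ∨ v ∉ N.nonroot r) (hR : N.R ≠ {r})
    (hh : Halted N r s) : Reached N r s := by
  rcases hh with hh | hQ
  · exact hh
  · have hne : (N.nonroot r).Nonempty := by
      rw [Finset.nonempty_iff_ne_empty]
      intro h
      rcases (Finset.erase_eq_empty_iff _ _).1 h with h | h
      · exact N.R_nonempty.ne_empty h
      · exact hR h
    have ho := hs.optimal_of_queue_empty hinit hQ _ _ r _ rfl rfl (good_root hr hne)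
    exact (hs.queued _ _ ho).resolve_right (by simp [hQ])

/-! ### The number of iterations -/

/-- The number of expansions of tuples `(v, I)` with `I ⊂ K`. -/
def lowerCount [Fintype V] (a : Tuple V → ℕ) (K : Finset V) : ℕ :=
  ∑ I ∈ K.ssubsets, ∑ v, a (v, I)

/-- The number of expansions of tuples `(q, K)` with larger value of `g` than `v`. -/
def higherCount [Fintype V] (g : V → ℕ) (a : Tuple V → ℕ) (v : V) (K : Finset V) : ℕ :=
  ∑ q with g v < g q, a (q, K)

/-- Two expansions of `(v, K)` are separated by an expansion of some `(q, K)` with larger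
heuristic value, or of some `(q, I)` with `I ⊂ K`. Here `a` counts the expansions so far. -/
structure Count [Fintype V] (N : STPInstance V) (r : V) (h : V → Finset V → ℕ) (a : Tuple V → ℕ)
    (s : State V) : Prop where
  supp : ∀ p, a p ≠ 0 → p.2 ⊆ N.nonroot r ∧ p.2.Nonempty
  le : ∀ v K, a (v, K) ≤ higherCount (h · (N.R \ K)) a v K + lowerCount a K + 1
  locked : ∀ v K, a (v, K) = higherCount (h · (N.R \ K)) a v K + lowerCount a K + 1 →
    (v, K) ∉ s.Q ∧ ∀ q, (q, K) ∈ s.Q → h q (N.R \ K) ≤ h v (N.R \ K) → s.l (v, K) ≤ s.l (q, K)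

theorem higherCount_mono [Fintype V] {g : V → ℕ} {a a' : Tuple V → ℕ} (ha : ∀ p, a p ≤ a' p)
    (v : V) (K : Finset V) : higherCount g a v K ≤ higherCount g a' v K :=
  Finset.sum_le_sum fun _ _ => ha _

theorem lowerCount_mono [Fintype V] {a a' : Tuple V → ℕ} (ha : ∀ p, a p ≤ a' p)
    (K : Finset V) : lowerCount a K ≤ lowerCount a' K :=
  Finset.sum_le_sum fun _ _ => Finset.sum_le_sum fun _ _ => ha _

theorem higherCount_lt [Fintype V] {g : V → ℕ} {a a' : Tuple V → ℕ} (ha : ∀ p, a p ≤ a' p)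
    {v w : V} {K : Finset V} (hlt : a (w, K) < a' (w, K)) (hg : g v < g w) :
    higherCount g a v K < higherCount g a' v K :=
  Finset.sum_lt_sum (fun _ _ => ha _) ⟨w, by simpa using hg, hlt⟩

theorem lowerCount_lt [Fintype V] {a a' : Tuple V → ℕ} (ha : ∀ p, a p ≤ a' p)
    {w : V} {I K : Finset V} (hlt : a (w, I) < a' (w, I)) (hIK : I ⊂ K) :
    lowerCount a K < lowerCount a' K :=
  Finset.sum_lt_sum (fun _ _ => Finset.sum_le_sum fun _ _ => ha _)
    ⟨I, Finset.mem_ssubsets.2 hIK,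
      Finset.sum_lt_sum (fun _ _ => ha _) ⟨w, Finset.mem_univ _, hlt⟩⟩

/-- Equality in `le` is the locked state. Expanding `(v, K)` gives the required comparison of labels
by minimality of its key. Any later expansion either raises one of the two counts, which ends
equality, or creates no label in layer `K` below that of `(v, K)`. -/
theorem Count.step [Fintype V] {r w : V} {I : Finset V} {h : V → Finset V → ℕ} {a : Tuple V → ℕ}
    {s s' : State V} (hc : Count N r h a s) (hw : (w, I) ∈ s.Q)
    (hI : I ⊆ N.nonroot r ∧ I.Nonempty) (hkey : ∀ q ∈ s.Q, key N h s (w, I) ≤ key N h s q)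
    (hf : Frame w I s s') :
    Count N r h (Function.update a (w, I) (a (w, I) + 1)) s' := by
  set a' := Function.update a (w, I) (a (w, I) + 1) with ha'
  have hself : a' (w, I) = a (w, I) + 1 := Function.update_self _ _ _
  have hne : ∀ p, p ≠ (w, I) → a' p = a p := fun p hp => Function.update_of_ne hp _ _
  have hmono : ∀ p, a p ≤ a' p := by
    intro p
    by_cases hp : p = (w, I)
    · rw [hp, hself]; omega
    · rw [hne p hp]
  have hlt : a (w, I) < a' (w, I) := by omega
  refine ⟨?_, ?_, ?_⟩
  · intro p hp
    by_cases hpw : p = (w, I)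
    · rw [hpw]; exact hI
    · exact hc.supp p (by rwa [← hne p hpw])
  · intro v K
    have h₁ := higherCount_mono (g := (h · (N.R \ K))) hmono v K
    have h₂ := lowerCount_mono hmono K
    have h₃ := hc.le v K
    by_cases hv : (v, K) = (w, I)
    · have h₄ : a (v, K) ≠ _ := fun he => (hc.locked v K he).1 (hv ▸ hw)
      rw [hv, hself, ← hv]
      omega
    · rw [hne _ hv]
      omega
  · intro v K he
    have h₁ := higherCount_mono (g := (h · (N.R \ K))) hmono v K
    have h₂ := lowerCount_mono hmono K
    have h₃ := hc.le v K
    by_cases hv : (v, K) = (w, I)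
    · obtain ⟨rfl, rfl⟩ := Prod.ext_iff.1 hv
      refine ⟨hf.self_notMem, fun q hq hhq => ?_⟩
      rw [hf.self]
      rcases hf.layer q with ⟨hl, hqQ⟩ | hl
      · rw [hl]
        have hk := hkey (q, K) (hqQ hq)
        simp only [key] at hk
        have hk' : s.l (v, K) + (h v (N.R \ K) : ℕ∞) ≤ s.l (q, K) + (h v (N.R \ K) : ℕ∞) :=
          hk.trans (add_le_add le_rfl (by exact_mod_cast hhq))
        exact (ENat.add_le_add_iff_right (ENat.natCast_ne_top _)).1 hk'
      · exact hl.le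
    · rw [hne _ hv] at he
      -- The right side never decreases and bounded `a (v, K)` before; equality now forces equality
      -- before, with both counts unchanged.
      have he' : a (v, K) = higherCount (h · (N.R \ K)) a v K + lowerCount a K + 1 := by omega
      obtain ⟨hvQ, hvl⟩ := hc.locked v K he'
      by_cases hKI : K = I
      · subst hKI
        have hhw : h w (N.R \ K) ≤ h v (N.R \ K) := by
          by_contra hcon
          have := higherCount_lt (g := (h · (N.R \ K))) (v := v) hmono hlt (not_le.1 hcon)
          omega
        have hvw := hvl w hw hhw
        rcases hf.layer v with ⟨hlv, hvQ'⟩ | hlv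
        swap
        -- A changed label would exceed that of `(w, K)`, hence the old label of `(v, K)`, but
        -- labels never increase.
        · exact absurd (hlv.trans_le (hf.le _)) (not_lt.2 hvw)
        refine ⟨fun h => hvQ (hvQ' h), fun q hq hhq => ?_⟩
        rw [hlv]
        rcases hf.layer q with ⟨hl, hqQ⟩ | hl
        · rw [hl]
          exact hvl q (hqQ hq) hhq
        · exact hvw.trans hl.le
      · have hIK : ¬ I ⊂ K := fun hIK => by
          have := lowerCount_lt hmono hlt hIK
          omega
        have hfr : ∀ q, s'.l (q, K) = s.l (q, K) ∧ ((q, K) ∈ s'.Q ↔ (q, K) ∈ s.Q) :=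
          fun q => hf.other (q, K) hKI hIK
        refine ⟨fun h => hvQ ((hfr v).2.1 h), fun q hq hhq => ?_⟩
        rw [(hfr v).1, (hfr q).1]
        exact hvl q ((hfr q).2.1 hq) hhq

/-- A new vertex of least `g` contributes at most the sum so far plus `c`, so the sum plus `c` at
most doubles. -/
theorem sum_add_le_of_le_higher [Fintype V] (f g : V → ℕ) (c : ℕ)
    (hf : ∀ v, f v ≤ (∑ q with g v < g q, f q) + c) :
    ∑ v, f v + c ≤ 2 ^ Fintype.card V * c := by
  suffices H : ∀ S : Finset V, (∀ v ∈ S, f v ≤ (∑ q ∈ S with g v < g q, f q) + c) →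
      ∑ v ∈ S, f v + c ≤ 2 ^ S.card * c from H Finset.univ fun v _ => hf v
  intro S
  induction S using Finset.induction_on_min_value g with
  | empty => simp
  | insert x S hx hmin ih =>
    intro hS
    have h₁ := ih fun v hv => by
      have := hS v (Finset.mem_insert_of_mem hv)
      rwa [Finset.filter_insert, if_neg (not_lt.2 (hmin v hv))] at this
    have h₂ : f x ≤ ∑ q ∈ S, f q + c := by
      have := hS x (Finset.mem_insert_self _ _)
      rw [Finset.filter_insert, if_neg (lt_irrefl _)] at this
      exact this.trans (Nat.add_le_add_right
        (Finset.sum_le_sum_of_subset (Finset.filter_subset _ _)) _)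
    rw [Finset.sum_insert hx, Finset.card_insert_of_notMem hx, pow_succ]
    linarith

/-- Passing from smaller sets to `K` costs a factor `2 ^ m` for the choice of the subset and `2 ^
|V|` for the vertices; `D` covers both exponents. -/
theorem Count.layer_le [Fintype V] {r : V} {h : V → Finset V → ℕ} {a : Tuple V → ℕ}
    {s : State V} (hc : Count N r h a s) {D : ℕ}
    (hD : Fintype.card V + (N.nonroot r).card ≤ D) :
    ∀ (m : ℕ) (K : Finset V), K ⊆ N.nonroot r → K.card = m →
      ∑ v, a (v, K) + 1 ≤ 2 ^ (D * m) := by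
  intro m
  induction m using Nat.strong_induction_on with
  | _ m ih =>
  intro K hK hm
  rcases K.eq_empty_or_nonempty with rfl | hne
  · have : ∑ v, a (v, ∅) = 0 := Finset.sum_eq_zero fun v _ => by
      by_contra hcon
      simpa using (hc.supp (v, ∅) hcon).2
    rw [this]
    exact Nat.one_le_two_pow
  have hmpos : 0 < m := hm ▸ hne.card_pos
  have h₁ : lowerCount a K + 1 ≤ 2 ^ m * 2 ^ (D * (m - 1)) := by
    -- The proper subset `∅` pays for the extra `1`.
    have hcard : 1 ≤ K.ssubsets.card :=
      Finset.card_pos.2 ⟨∅, Finset.mem_ssubsets.2 (Finset.empty_ssubset.2 hne)⟩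
    calc lowerCount a K + 1 ≤ ∑ I ∈ K.ssubsets, (∑ v, a (v, I) + 1) := by
          rw [Finset.sum_add_distrib, Finset.sum_const, smul_eq_mul, mul_one]
          exact Nat.add_le_add_left hcard _
      _ ≤ ∑ I ∈ K.ssubsets, 2 ^ (D * (m - 1)) := by
          refine Finset.sum_le_sum fun I hI => ?_
          have hI := Finset.mem_ssubsets.1 hI
          have hlt := Finset.card_lt_card hI
          refine (ih I.card (by omega) I (hI.subset.trans hK) rfl).trans ?_
          exact Nat.pow_le_pow_right (by norm_num) (Nat.mul_le_mul_left _ (by omega))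
      _ ≤ 2 ^ m * 2 ^ (D * (m - 1)) := by
          rw [Finset.sum_const, smul_eq_mul]
          refine Nat.mul_le_mul_right _ ?_
          rw [← hm, ← Finset.card_powerset]
          exact Finset.card_le_card (Finset.erase_subset _ _)
  have h₂ := sum_add_le_of_le_higher (fun v => a (v, K)) (h · (N.R \ K)) (lowerCount a K + 1)
    fun v => by
      have := hc.le v K
      unfold higherCount at this
      omega
  have hmk : m ≤ (N.nonroot r).card := hm ▸ Finset.card_le_card hK
  calc ∑ v, a (v, K) + 1 ≤ ∑ v, a (v, K) + (lowerCount a K + 1) := by omega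
    _ ≤ 2 ^ Fintype.card V * (lowerCount a K + 1) := h₂
    _ ≤ 2 ^ Fintype.card V * (2 ^ m * 2 ^ (D * (m - 1))) := Nat.mul_le_mul_left _ h₁
    _ = 2 ^ (Fintype.card V + m + D * (m - 1)) := by rw [pow_add, pow_add, mul_assoc]
    _ ≤ 2 ^ (D * m) := by
        refine Nat.pow_le_pow_right (by norm_num) ?_
        obtain ⟨m, rfl⟩ := Nat.exists_eq_add_of_lt hmpos
        simp only [zero_add, Nat.add_sub_cancel, Nat.mul_succ]
        omega

theorem Count.total_le [Fintype V] {r : V} {h : V → Finset V → ℕ} {a : Tuple V → ℕ}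
    {s : State V} (hc : Count N r h a s) :
    ∑ K ∈ (N.nonroot r).powerset, ∑ v, a (v, K) ≤
      2 ^ ((N.nonroot r).card +
        (Fintype.card V + (N.nonroot r).card) * (N.nonroot r).card) := by
  rw [pow_add]
  calc _ ≤ ∑ K ∈ (N.nonroot r).powerset,
          2 ^ ((Fintype.card V + (N.nonroot r).card) * (N.nonroot r).card) := by
        refine Finset.sum_le_sum fun K hK => ?_
        have hK := Finset.mem_powerset.1 hK
        refine (Nat.le_succ _).trans ((hc.layer_le le_rfl _ K hK rfl).trans ?_)
        exact Nat.pow_le_pow_right (by norm_num)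
          (Nat.mul_le_mul_left _ (Finset.card_le_card hK))
    _ = _ := by rw [Finset.sum_const, smul_eq_mul, Finset.card_powerset]

/-! ### The time of an iteration -/

theorem card_nonroot {r : V} (hr : r ∈ N.R) : (N.nonroot r).card + 1 = N.R.card :=
  Finset.card_erase_add_one hr

theorem expansion_time_le [Fintype V] {mode : Pruning} {r w : V} (hr : r ∈ N.R) {I : Finset V}
    {s s₁ s' : State V} (hq : ∀ p ∈ s.Q, p.2 ⊆ N.nonroot r) (hw : (w, I) ∈ s.Q)
    {Js : List (Finset V)} {vs : List V}
    (hJn : Js.Nodup) (hJs : ∀ J, J ∈ Js ↔ J ⊆ N.nonroot r \ I)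
    (hvn : vs.Nodup)
    (h₁ : ForEach (MergeBody N mode w I) Js (select N (w, I) s) s₁)
    (h₂ : ForEach (EdgeBody N mode w I) vs s₁ s') :
    s'.time ≤ s.time + 71 * (N.R.card * (Fintype.card V * 2 ^ (N.nonroot r).card)) := by
  have hI := hq _ hw
  have hIR : I ⊆ N.R := hI.trans (nonroot_subset r)
  have t₁ := h₁.time_le (B := 40 * N.R.card ^ 2) fun J hJ t t' h => h.time_le
    (Finset.union_subset hIR (((hJs J).1 hJ).trans (Finset.sdiff_subset.trans (nonroot_subset r))))
  have t₂ := h₂.time_le (B := 22 * N.R.card ^ 2) fun v hv t t' h => h.time_le hIR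
  have hJlen : Js.length ≤ 2 ^ (N.nonroot r).card := by
    rw [← List.toFinset_card_of_nodup hJn, ← Finset.card_powerset]
    refine Finset.card_le_card fun J hJ => Finset.mem_powerset.2 ?_
    exact ((hJs J).1 (List.mem_toFinset.1 hJ)).trans Finset.sdiff_subset
  have hvlen : vs.length ≤ Fintype.card V := hvn.length_le_card
  have hQ : s.Q.card ≤ Fintype.card V * 2 ^ (N.nonroot r).card := by
    have : s.Q ⊆ Finset.univ ×ˢ (N.nonroot r).powerset := fun p hp =>
      Finset.mem_product.2 ⟨Finset.mem_univ _, Finset.mem_powerset.2 (hq p hp)⟩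
    refine (Finset.card_le_card this).trans ?_
    rw [Finset.card_product, Finset.card_powerset, Finset.card_univ]
  have hkn : N.R.card ≤ Fintype.card V := Finset.card_le_univ _
  have hk : 1 ≤ N.R.card := N.R_nonempty.card_pos
  have hk2 : N.R.card ≤ 2 ^ (N.nonroot r).card := by
    rw [← card_nonroot hr]
    exact Nat.lt_two_pow_self
  simp only [select] at t₁
  generalize N.R.card = k at *
  generalize Fintype.card V = n at *
  generalize 2 ^ (N.nonroot r).card = z at *
  -- One factor of `k ^ 2` is absorbed by `n` here and by `z` in the edge loop, leaving a single
  -- `|R|`. With the queue scan and the selection overhead, `40 + 22 + 5 + 4 = 71`.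
  have e₁ : Js.length * (40 * k ^ 2) ≤ 40 * (k * (n * z)) :=
    calc Js.length * (40 * k ^ 2) ≤ z * (40 * (k * n)) := by
          rw [pow_two]
          exact Nat.mul_le_mul hJlen (Nat.mul_le_mul_left _ (Nat.mul_le_mul_left _ hkn))
      _ = _ := by ring
  have e₂ : vs.length * (22 * k ^ 2) ≤ 22 * (k * (n * z)) :=
    calc vs.length * (22 * k ^ 2) ≤ n * (22 * (k * z)) := by
          rw [pow_two]
          exact Nat.mul_le_mul hvlen (Nat.mul_le_mul_left _ (Nat.mul_le_mul_left _ hk2))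
      _ = _ := by ring
  have e₃ : s.Q.card * (k + 4) ≤ 5 * (k * (n * z)) :=
    calc s.Q.card * (k + 4) ≤ (n * z) * (5 * k) := Nat.mul_le_mul hQ (by omega)
      _ = _ := by ring
  have e₄ : k ≤ k * (n * z) :=
    Nat.le_mul_of_pos_right _ (Nat.mul_pos (by omega) (by omega))
  omega

/-! ### Retracing -/

/-- A bound for the number of recursive calls when the tree is retraced from `p`. -/
def retraceBound [Fintype V] (l : Tuple V → ℕ∞) (p : Tuple V) : ℕ :=
  2 * (p.2.card - 1) * Fintype.card V + (Finset.univ.filter fun v => l (v, p.2) < l p).card + 1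

theorem rank_lt [Fintype V] (l : Tuple V → ℕ∞) (p : Tuple V) :
    (Finset.univ.filter fun v => l (v, p.2) < l p).card < Fintype.card V :=
  Finset.card_lt_univ_of_notMem (x := p.1) (by simp)

/-- An edge pointer lowers the rank within the layer. A partition pointer gives no control of ranks,
but these are below `|V|`, and splitting the set frees `2 * |V|`, enough for two new ranks and the
call itself. The time is quadratic because each call also handles the returned edge sets. -/
theorem exists_retrace [Fintype V] {l : Tuple V → ℕ∞} {b : Tuple V → Finset (Tuple V)}
    (hb : ∀ p, b p = ∅ ∨ BackForm l p (l p) (b p)) :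
    ∀ (m : ℕ) (p : Tuple V), p.2.Nonempty → retraceBound l p = m →
      ∃ (E : Finset (Sym2 V)) (t : ℕ), Retrace b p E t ∧ E.card + 1 ≤ m ∧ t ≤ 4 * m ^ 2 := by
  intro m
  induction m using Nat.strong_induction_on with
  | _ m ih =>
  intro p hp hm
  have hm1 : 1 ≤ m := by rw [← hm]; exact Nat.le_add_left _ _
  rcases hb p with h₀ | ⟨w, hw, hB, hlt⟩ | ⟨I, J, hI, hJ, hd, hIJ, hB⟩
  · refine ⟨_, _, Retrace.call p (fun _ => ∅) (fun _ => 0) (by simp [h₀]), ?_, ?_⟩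
    · simpa [h₀] using hm1
    · simp only [h₀, Finset.sum_empty]
      nlinarith
  · have hlt' : retraceBound l (w, p.2) < m := by
      have : (Finset.univ.filter fun v => l (v, p.2) < l (w, p.2)).card <
          (Finset.univ.filter fun v => l (v, p.2) < l p).card := by
        refine Finset.card_lt_card (Finset.ssubset_iff_subset_ne.2 ⟨?_, fun he => ?_⟩)
        · intro v hv
          simp only [Finset.mem_filter, Finset.mem_univ, true_and] at hv ⊢
          exact hv.trans hlt
        · have : w ∈ Finset.univ.filter fun v => l (v, p.2) < l (w, p.2) := by
            rw [he]
            simpa using hlt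
          simp at this
      rw [← hm]
      simp only [retraceBound]
      omega
    obtain ⟨E, t, hr, hE, ht⟩ := ih _ hlt' (w, p.2) hp rfl
    refine ⟨_, _, Retrace.call p (fun _ => E) (fun _ => t) (by simpa [hB] using hr), ?_, ?_⟩
    · rw [hB, Finset.singleton_biUnion]
      have h₁ := Finset.card_union_le E (if p.1 = w then ∅ else {s(p.1, w)})
      have h₂ : (if p.1 = w then (∅ : Finset (Sym2 V)) else {s(p.1, w)}).card ≤ 1 := by
        split_ifs <;> simp
      simp only
      omega
    · rw [hB, Finset.sum_singleton]
      nlinarith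
  · have hne : (p.1, I) ≠ (p.1, J) := by
      intro he
      obtain ⟨x, hx⟩ := hI
      have he' : I = J := (Prod.ext_iff.1 he).2
      exact Finset.disjoint_left.1 hd hx (he' ▸ hx)
    have hcard : I.card + J.card = p.2.card := by
      rw [← hIJ, Finset.card_union_of_disjoint hd]
    have hI' := hI.card_pos
    have hJ' := hJ.card_pos
    have hsum : retraceBound l (p.1, I) + retraceBound l (p.1, J) + 1 ≤ m := by
      have h₁ := rank_lt l (p.1, I)
      have h₂ := rank_lt l (p.1, J)
      have h₃ : p.2.card - 1 = (I.card - 1) + (J.card - 1) + 1 := by omega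
      rw [← hm]
      simp only [retraceBound] at h₁ h₂ ⊢
      rw [h₃]
      generalize I.card - 1 = i at *
      generalize J.card - 1 = j at *
      have : 2 * (i + j + 1) * Fintype.card V =
        2 * i * Fintype.card V + 2 * j * Fintype.card V + 2 * Fintype.card V := by ring
      omega
    have hpos₁ : 1 ≤ retraceBound l (p.1, I) := Nat.le_add_left _ _
    have hpos₂ : 1 ≤ retraceBound l (p.1, J) := Nat.le_add_left _ _
    obtain ⟨E₁, t₁, hr₁, hE₁, ht₁⟩ := ih _ (by omega) (p.1, I) hI rfl
    obtain ⟨E₂, t₂, hr₂, hE₂, ht₂⟩ := ih _ (by omega) (p.1, J) hJ rfl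
    refine ⟨_, _, Retrace.call p (fun q => if q = (p.1, I) then E₁ else E₂)
      (fun q => if q = (p.1, I) then t₁ else t₂) ?_, ?_, ?_⟩
    · intro q hq
      rw [hB, Finset.mem_insert, Finset.mem_singleton] at hq
      rcases hq with rfl | rfl
      · simpa using hr₁
      · simpa [hne.symm] using hr₂
    · rw [hB, Finset.biUnion_insert, Finset.singleton_biUnion]
      simp only [if_true, if_neg hne.symm, Finset.union_empty]
      have := Finset.card_union_le E₁ E₂
      omega
    · rw [hB, Finset.sum_pair hne]
      simp only [if_true, if_neg hne.symm]
      nlinarith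

/-! ### Executions -/

/-- The total of the counter `a` is exactly `i`, so `Count.total_le` bounds the number of iterations
and also yields termination. -/
theorem execution_inv [Fintype V] {r : V} (hr : r ∈ N.R) {h : V → Finset V → ℕ} {mode : Pruning}
    {x : ℕ → State V} (hx : IsExecution N r h mode x) (i : ℕ)
    (hi : ∀ j < i, ¬ Halted N r (x j)) :
    ∃ a : Tuple V → ℕ, Inv N r ∅ (x i) ∧ Count N r h a (x i) ∧
      ∑ K ∈ (N.nonroot r).powerset, ∑ v, a (v, K) = i ∧
      (x i).time ≤ (init N r).time +
        i * (71 * (N.R.card * (Fintype.card V * 2 ^ (N.nonroot r).card))) ∧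
      ∀ q, (x i).l q ≤ (init N r).l q := by
  induction i with
  | zero =>
    rw [hx.1]
    refine ⟨fun _ => 0, init_inv, ⟨fun p hp => absurd rfl hp, fun _ _ => Nat.zero_le _, ?_⟩,
      by simp, by simp, fun _ => le_rfl⟩
    intro v K he
    exact absurd he (by omega)
  | succ i ih =>
    obtain ⟨a, hinv, hcount, hsum, htime, hle⟩ := ih fun j hj => hi j (by omega)
    obtain ⟨-, w, I, hw, hkey, Js, vs, hJn, hJs, hvn, hvs, s₁, h₁, h₂⟩ :=
      (hx.2 i).resolve_left fun hh => hi i (by omega) hh.1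
    obtain ⟨hinv', hframe⟩ := expansion_inv hr hinv hw hJs hvs h₁ h₂
    have hI := hinv.queue _ hw
    refine ⟨_, hinv', hcount.step hw hI hkey hframe, ?_, ?_,
      fun q => (hframe.le q).trans (hle q)⟩
    · rw [← hsum, ← Finset.sum_product', ← Finset.sum_product']
      have hmem : (I, w) ∈ (N.nonroot r).powerset ×ˢ (Finset.univ : Finset V) := by
        simpa using hI.1
      rw [← Finset.add_sum_erase _ _ hmem, ← Finset.add_sum_erase _ (fun y => a (y.2, y.1)) hmem,
        Function.update_self, add_right_comm]
      congr 2
      refine Finset.sum_congr rfl fun y hy => Function.update_of_ne ?_ _ _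
      intro he
      exact (Finset.mem_erase.1 hy).1 (Prod.ext_iff.2 ⟨(Prod.ext_iff.1 he).2, (Prod.ext_iff.1 he).1⟩)
    · have := expansion_time_le hr (fun p hp => (hinv.queue p hp).1) hw hJn hJs hvn h₁ h₂
      rw [Nat.succ_mul]
      omega

/-! ### Elementary estimates and the final bound -/

theorem sq_le_two_pow (n : ℕ) : n ^ 2 ≤ 2 * 2 ^ n := by
  induction n with
  | zero => norm_num
  | succ n ih =>
    rcases Nat.lt_or_ge n 3 with hn | hn
    · interval_cases n <;> norm_num
    · rw [pow_succ 2 n]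
      nlinarith

theorem cube_le_two_pow (n : ℕ) : n ^ 3 ≤ 8 * 2 ^ n := by
  induction n with
  | zero => norm_num
  | succ n ih =>
    rcases Nat.lt_or_ge n 4 with hn | hn
    · interval_cases n <;> norm_num
    · have : (n + 1) ^ 3 ≤ 2 * n ^ 3 := by
        obtain ⟨m, rfl⟩ := Nat.exists_eq_add_of_le hn
        ring_nf
        nlinarith [Nat.zero_le (m ^ 3), Nat.zero_le (m ^ 2)]
      rw [pow_succ 2 n]
      omega

theorem init_time_le [Fintype V] {r : V} (hr : r ∈ N.R) :
    (init N r).time ≤ 20 * 2 ^ (N.R.card * (Fintype.card V + N.R.card)) := by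
  have hk := card_nonroot hr
  have hcube := cube_le_two_pow (Fintype.card V)
  have hkn : N.R.card ≤ Fintype.card V := Finset.card_le_univ _
  simp only [init]
  set n := Fintype.card V
  set j := (N.nonroot r).card
  rw [← hk] at hkn ⊢
  set Z := 2 ^ ((j + 1) * (n + (j + 1))) with hZ
  have hexp : n + j ≤ (j + 1) * (n + (j + 1)) := by nlinarith
  have h₁ : 2 ^ n * 2 ^ j ≤ Z := by
    rw [← pow_add]
    exact Nat.pow_le_pow_right (by norm_num) hexp
  have h₂ : n < 2 ^ n := Nat.lt_two_pow_self
  have h₃ : 1 ≤ 2 ^ j := Nat.one_le_two_pow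
  have h₄ : 2 ^ n ≤ Z := (Nat.le_mul_of_pos_right _ h₃).trans h₁
  have h₅ : 2 ^ j ≤ Z := (Nat.le_mul_of_pos_left _ (by positivity)).trans h₁
  have h₆ : n * 2 ^ j ≤ Z := (Nat.mul_le_mul_right _ h₂.le).trans h₁
  omega

theorem iterations_mul_le (k n j : ℕ) :
    2 ^ (j + (n + j) * j) * (71 * (k * (n * 2 ^ j))) ≤
      71 * (k * 2 ^ ((j + 1) * (n + (j + 1)))) := by
  have h : 2 ^ (j + (n + j) * j) * (n * 2 ^ j) ≤ 2 ^ ((j + 1) * (n + (j + 1))) := by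
    calc 2 ^ (j + (n + j) * j) * (n * 2 ^ j) ≤ 2 ^ (j + (n + j) * j) * (2 ^ n * 2 ^ j) :=
          Nat.mul_le_mul_left _ (Nat.mul_le_mul_right _ Nat.lt_two_pow_self.le)
      _ = 2 ^ (j + (n + j) * j + (n + j)) := by rw [← pow_add, ← pow_add]
      _ ≤ _ := Nat.pow_le_pow_right (by norm_num) (by nlinarith)
  calc _ = 71 * (k * (2 ^ (j + (n + j) * j) * (n * 2 ^ j))) := by ring
    _ ≤ _ := Nat.mul_le_mul_left _ (Nat.mul_le_mul_left _ h)

/-- Here `112 = (4 + 3) * 16`, where `16 = 4 * 2 * 2` comes from bounding `m ^ 2`. -/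
theorem retrace_mul_le {n j m : ℕ} (hm : m ≤ 2 * j * n) :
    4 * m ^ 2 + 3 * m ≤ 112 * 2 ^ ((j + 1) * (n + (j + 1))) := by
  have h₁ : m ^ 2 ≤ 4 * (j ^ 2 * n ^ 2) := by
    calc m ^ 2 ≤ (2 * j * n) ^ 2 := Nat.pow_le_pow_left hm 2
      _ = _ := by ring
  have h₂ : j ^ 2 * n ^ 2 ≤ (2 * 2 ^ j) * (2 * 2 ^ n) :=
    Nat.mul_le_mul (sq_le_two_pow j) (sq_le_two_pow n)
  have h₃ : 2 ^ j * 2 ^ n ≤ 2 ^ ((j + 1) * (n + (j + 1))) := by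
    rw [← pow_add]
    exact Nat.pow_le_pow_right (by norm_num) (by nlinarith)
  have h₄ : m ≤ m ^ 2 := Nat.le_self_pow (by norm_num) _
  nlinarith

theorem exists_halted [Fintype V] {r : V} (hr : r ∈ N.R) {h : V → Finset V → ℕ}
    {mode : Pruning} {x : ℕ → State V} (hx : IsExecution N r h mode x) :
    ∃ i, Halted N r (x i) ∧ ∀ j < i, ¬ Halted N r (x j) := by
  classical
  have hex : ∃ i, Halted N r (x i) := by
    by_contra hcon
    push Not at hcon
    obtain ⟨a, -, hcount, hsum, -⟩ := execution_inv hr hx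
      (2 ^ ((N.nonroot r).card +
        (Fintype.card V + (N.nonroot r).card) * (N.nonroot r).card) + 1) fun j _ => hcon j
    have := hcount.total_le
    omega
  exact ⟨Nat.find hex, Nat.find_spec hex, fun j hj => Nat.find_min hex hj⟩

theorem execution_time_le [Fintype V] {r : V} (hr : r ∈ N.R) {h : V → Finset V → ℕ}
    {mode : Pruning} {x : ℕ → State V} (hx : IsExecution N r h mode x) {i : ℕ}
    (hi : ∀ j < i, ¬ Halted N r (x j)) :
    (x i).time ≤ 91 * (N.R.card * 2 ^ (N.R.card * (Fintype.card V + N.R.card))) := by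
  obtain ⟨a, -, hcount, hsum, htime, -⟩ := execution_inv hr hx i hi
  have h₁ := hcount.total_le
  rw [hsum] at h₁
  have h₂ := Nat.mul_le_mul_right
    (71 * (N.R.card * (Fintype.card V * 2 ^ (N.nonroot r).card))) h₁
  have h₃ := iterations_mul_le N.R.card (Fintype.card V) (N.nonroot r).card
  rw [card_nonroot hr] at h₃
  have h₄ := init_time_le hr
  have h₅ : 2 ^ (N.R.card * (Fintype.card V + N.R.card)) ≤
      N.R.card * 2 ^ (N.R.card * (Fintype.card V + N.R.card)) :=
    Nat.le_mul_of_pos_left _ N.R_nonempty.card_pos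
  omega

theorem two_pow_le_bound [Fintype V] (N : STPInstance V) :
    2 ^ (N.R.card * (Fintype.card V + N.R.card)) ≤
      (Fintype.card V + 2 ^ N.R.card) ^ (Fintype.card V + N.R.card) := by
  rw [pow_mul]
  exact Nat.pow_le_pow_left (Nat.le_add_left _ _) _

/-- Initialization and main loop take `20 + 71 = 91` units, retracing and output `112`; `206` leaves
some slack. -/
theorem runsInTime [Fintype V] {r : V} (hr : r ∈ N.R) (h : V → Finset V → ℕ) (mode : Pruning) :
    RunsInTime N r h mode
      (206 * (N.R.card * (Fintype.card V + 2 ^ N.R.card) ^ (Fintype.card V + N.R.card))) := by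
  intro x hx
  obtain ⟨i, hi, hmin⟩ := exists_halted hr hx
  obtain ⟨a, hinv, -, -, -, hle⟩ := execution_inv hr hx i hmin
  have hreach : N.R ≠ {r} → Reached N r (x i) := by
    intro hR
    refine hinv.reached hr (fun v => ?_) hR hi
    by_cases hv : v ∈ N.nonroot r
    · left
      have := hle (v, {v})
      simpa [init, hv] using this
    · exact Or.inr hv
  have htime := execution_time_le hr hx hmin
  have hZ := Nat.mul_le_mul_left N.R.card (two_pow_le_bound N)
  have hZ' : 2 ^ (N.R.card * (Fintype.card V + N.R.card)) ≤
      N.R.card * 2 ^ (N.R.card * (Fintype.card V + N.R.card)) :=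
    Nat.le_mul_of_pos_left _ N.R_nonempty.card_pos
  have hone : 1 ≤ 2 ^ (N.R.card * (Fintype.card V + N.R.card)) := Nat.one_le_two_pow
  refine ⟨i, hi, hreach, ?_⟩
  rcases (N.nonroot r).eq_empty_or_nonempty with he | hne
  -- Without a terminal besides the root the initial queue is empty, and retracing meets only empty
  -- pointers.
  · have hi0 : i = 0 := by
      by_contra h0
      refine hmin 0 (Nat.pos_of_ne_zero h0) (Or.inr ?_)
      rw [hx.1]
      simp [init, he]
    subst hi0
    have hb : (x 0).b (r, N.nonroot r) = ∅ := by rw [hx.1]; rfl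
    refine ⟨_, _, Retrace.call _ (fun _ => ∅) (fun _ => 0) (by simp [hb]), ?_⟩
    simp only [hb, Finset.biUnion_empty, Finset.sum_empty, Finset.card_empty]
    omega
  · obtain ⟨E, t, hret, hE, ht⟩ := exists_retrace hinv.back _ (r, N.nonroot r) hne rfl
    have hm : retraceBound (x i).l (r, N.nonroot r) ≤
        2 * (N.nonroot r).card * Fintype.card V := by
      have h₁ := rank_lt (x i).l (r, N.nonroot r)
      simp only [retraceBound] at h₁ ⊢
      obtain ⟨j, hj⟩ := Nat.exists_eq_add_of_lt hne.card_pos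
      rw [hj]
      simp only [zero_add, Nat.add_sub_cancel]
      have : 2 * (j + 1) * Fintype.card V = 2 * j * Fintype.card V + 2 * Fintype.card V := by ring
      omega
    have h₂ := retrace_mul_le hm
    rw [card_nonroot hr] at h₂
    refine ⟨E, t, hret, ?_⟩
    omega

end DSStar

end

theorem theorem2 :
    ∃ C : ℕ, ∀ (V : Type u) [Fintype V] [DecidableEq V] (N : STPInstance V) (r : V)
      (h : V → Finset V → ℕ), r ∈ N.R → N.Admissible r h → ∀ mode : DSStar.Pruning,
        DSStar.RunsInTime N r h mode
          (C * (N.R.card * (Fintype.card V + 2 ^ N.R.card) ^ (Fintype.card V + N.R.card))) :=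
  ⟨206, fun _ _ _ _ _ h hr _ mode => DSStar.runsInTime hr h mode⟩
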